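/- **Setting.** Let $j=\sqrt{-1}$. Scattering clusters $c$ have random central azimuth and elevation angles $\phi_c,\theta_c$; the subray $s$ that cluster $c$ scatters for user $l$ has random azimuth and elevation offsets $\Delta_{c,s}^{(l)},\delta_{c,s}^{(l)}$, so that its angles of arrival are $\phi_{c,s}^{(l)}=\phi_c+\Delta_{c,s}^{(l)}$ and $\theta_{c,s}^{(l)}=\theta_c+\delta_{c,s}^{(l)}$. All these variables are independent, and each of the four kinds is identically distributed, with an arbitrary law. Let $\chi_c^{\rm az}(n)=\mathbb E[e^{jn\phi_c}]$, $\chi_s^{\rm az}(n)=\mathbb E[e^{jn\Delta_{c,s}^{(l)}}]$, $\chi_s^{\rm el}(n)=\mathbb E[e^{jn\delta_{c,s}^{(l)}}]$ and $\chi_c^{\rm el}(n)=\mathbb E[e^{jn(\theta_c-\pi/2)}]$ (in elevation, the central angle is measured from $\pi/2$). A uniform circular array (UCA) with $M\ge 2$ antennas and spacing $d_r>0$ has steering vector $(\mathbf a(\phi,\theta))_m=\exp\big(j\frac{\pi d_r}{\sin(\pi/M)}\sin\theta\cos(\phi-\psi_m)\big)$, $\psi_m=2\pi m/M$, $0\le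 m\le M-1$. For two rays of different clusters $c\ne c'$, put $K_c=\frac1{M^2}\mathbb E\big|\mathbf a^{\rm H}(\phi_{c,s}^{(l)},\theta_{c,s}^{(l)})\,\mathbf a(\phi_{c',s'}^{(l')},\theta_{c',s'}^{(l')})\big|^2$; for two different rays $(l,s)\neq(l',s')$ of one cluster $c$, put $K_s=\frac1{M^2}\mathbb E\big|\mathbf a^{\rm H}(\phi_{c,s}^{(l)},\theta_{c,s}^{(l)})\,\mathbf a(\phi_{c,s'}^{(l')},\theta_{c,s'}^{(l')})\big|^2$. For $0\le m,m'\le M-1$ let $z_1=\cos\psi_{m'}-\cos\psi_m$, $z_2=\sin\psi_{m'}-\sin\psi_m$, $z_T=\frac{\pi d_r}{\sin(\pi/M)}\sqrt{z_1^2+z_2^2}$ and $\alpha=\tan^{-1}(z_1/z_2)$ (with $\alpha=\pi/2$ if $z_2=0$). Let $\rho(x)=\min(x,0)$, let $J_\nu$ be the Bessel function of the first kind of order $\nu$ (principal branch; products $J_\mu J_\nu$ at $0$ are read as limits), and put $$\zeta_c(n,n')=J_{|n'|/2-n}(z_T/2)\,J_{|n'|/2+n}(z_T/2),$$ $$\zeta_s(n,n',k,k')=e^{-j\frac{\pi}{2}(k+k')}J_{\frac{|n|-k}2}(-z_T/2)\,J_{\frac{|n|+k}2}(-z_T/2)\,(-1)^{\rho(n)+\rho(n')}\,J_{\frac{|n'|-k'}2}(z_T/2)\,J_{\frac{|n'|+k'}2}(z_T/2).$$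 **Statement.** For all $m,m'$ the double series below converges absolutely, and the quadruple series below converges in the sense that its partial sums over $|n|\le N$, $|n'|\le N'$, $|k|\le K$, $|k'|\le K'$ converge as $N,N',K,K'\to\infty$. If the elevation angles of the two rays lie in $(0,\pi)$ almost surely, then $$K_c=\frac1{M^2}\sum_{m,m'=0}^{M-1}\Big|\sum_{n=-\infty}^{\infty}\sum_{n'=-\infty}^{\infty}(-1)^{\rho(n')}\chi_c^{\rm az}(n')\chi_s^{\rm az}(n')\chi_c^{\rm el}(2n)\chi_s^{\rm el}(2n)\,e^{jn'\alpha}\,\zeta_c(n,n')\Big|^2$$ and $$K_s=\frac1{4M^2}\sum_{m,m'=0}^{M-1}\ \sum_{n,n',k,k'=-\infty}^{\infty}\chi_c^{\rm az}(n+n')\chi_s^{\rm az}(n)\chi_s^{\rm az}(n')\,\chi_c^{\rm el}(k+k')\chi_s^{\rm el}(k)\chi_s^{\rm el}(k')\,e^{j(n+n')\alpha}\,e^{j\frac{\pi}{2}(k+k')}\,\zeta_s(n,n',k,k').$$ For arbitrary laws, each of the two formulas holds up to an error of absolute value at most the probability that the elevation angles of the two rays concerned do not both lie in $(0,\pi)$.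 -/

import Mathlib

open MeasureTheory ProbabilityTheory Filter Topology

/-! ### Bessel functions of the first kind of real order -/

/-- The entire part of the Bessel function:
`besselLambda ν x = ∑ m, (-1)^m / (m! Γ(m + ν + 1)) (x / 2)^(2 m)`
(`1 / Γ` vanishes at the poles of `Γ`, as it should). -/
noncomputable def besselLambda (ν x : ℝ) : ℝ :=
  ∑' m : ℕ, (-1) ^ m / ((m.factorial : ℝ) * Real.Gamma ((m : ℝ) + ν + 1)) * (x / 2) ^ (2 * m)

/-- The Bessel function of the first kind `J_ν(x)` of real order `ν` at a real point `x`,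
with the principal branch of `(x / 2)^ν` for negative `x`. -/
noncomputable def besselJ (ν x : ℝ) : ℂ :=
  (((x / 2 : ℝ) : ℂ) ^ (ν : ℂ)) * (besselLambda ν x : ℂ)

/-- The product `J_μ(x) J_ν(x)`, read at `x = 0` as the limit for `x → 0` (one of the two factors
may be singular there, but the product extends continuously when `μ + ν` is a natural number,
see `besselJJ_eq`). -/
noncomputable def besselJJ (μ ν x : ℝ) : ℂ :=
  if x = 0 then limUnder (𝓝[≠] (0 : ℝ)) (fun t : ℝ => besselJ μ t * besselJ ν t)
  else besselJ μ x * besselJ ν x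

theorem continuous_besselLambda_zero (ν : ℝ) : ContinuousAt (besselLambda ν) 0 := by
  have hΓ : ∃ B : ℝ, ∀ m : ℕ, |(Real.Gamma ((m : ℝ) + ν + 1))⁻¹| ≤ B := by
    obtain ⟨N, hN⟩ := exists_nat_ge (1 - ν)
    have hev : ∀ m : ℕ, N ≤ m → |(Real.Gamma ((m : ℝ) + ν + 1))⁻¹| ≤ 1 := by
      intro m hm
      have hm' : (N : ℝ) ≤ m := by exact_mod_cast hm
      have h2 : (2 : ℝ) ≤ (m : ℝ) + ν + 1 := by linarith
      have h1 : (1 : ℝ) ≤ Real.Gamma ((m : ℝ) + ν + 1) := by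
        have h := Real.Gamma_strictMonoOn_Ici.monotoneOn (Set.mem_Ici.2 le_rfl) (Set.mem_Ici.2 h2) h2
        rwa [Real.Gamma_two] at h
      rw [abs_inv, abs_of_pos (by linarith)]
      exact inv_le_one_of_one_le₀ h1
    refine ⟨1 + ∑ m ∈ Finset.range N, |(Real.Gamma ((m : ℝ) + ν + 1))⁻¹|, fun m => ?_⟩
    have hs : 0 ≤ ∑ m ∈ Finset.range N, |(Real.Gamma ((m : ℝ) + ν + 1))⁻¹| :=
      Finset.sum_nonneg fun _ _ => abs_nonneg _
    by_cases hm : N ≤ m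
    · linarith [hev m hm]
    · have := Finset.single_le_sum (f := fun m : ℕ => |(Real.Gamma ((m : ℝ) + ν + 1))⁻¹|)
        (fun _ _ => abs_nonneg _) (Finset.mem_range.2 (not_le.1 hm))
      linarith
  obtain ⟨B, hB⟩ := hΓ
  have hB0 : 0 ≤ B := (abs_nonneg _).trans (hB 0)
  have hc : ContinuousOn (besselLambda ν) (Set.Icc (-1) 1) := by
    unfold besselLambda
    refine continuousOn_tsum (u := fun m : ℕ => B * (1 / 2) ^ m) (fun m => by fun_prop)
      (Summable.mul_left _ (summable_geometric_of_lt_one (by norm_num) (by norm_num))) ?_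
    intro m x hx
    rw [Real.norm_eq_abs, abs_mul, abs_div, abs_pow, abs_neg, abs_one, one_pow, abs_mul]
    have hx1 : |x| ≤ 1 := abs_le.2 ⟨hx.1, hx.2⟩
    have h2 : |(x / 2) ^ (2 * m)| ≤ (1 / 2) ^ m := by
      rw [abs_pow, pow_mul]
      refine pow_le_pow_left₀ (by positivity) ?_ m
      rw [abs_div, abs_two]
      nlinarith [abs_nonneg x]
    have h3 : 1 / (|(m.factorial : ℝ)| * |Real.Gamma ((m : ℝ) + ν + 1)|) ≤ B := by
      have hf : (1 : ℝ) ≤ |(m.factorial : ℝ)| := by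
        rw [Nat.abs_cast]
        exact_mod_cast Nat.one_le_iff_ne_zero.2 m.factorial_ne_zero
      have hb := hB m
      rw [abs_inv] at hb
      rw [one_div, mul_inv]
      calc |(m.factorial : ℝ)|⁻¹ * |Real.Gamma ((m : ℝ) + ν + 1)|⁻¹
          ≤ 1 * B := by
            refine mul_le_mul (inv_le_one_of_one_le₀ hf) hb (by positivity) (by norm_num)
        _ = B := one_mul B
    exact mul_le_mul h3 h2 (abs_nonneg _) hB0
  exact hc.continuousAt (Icc_mem_nhds (by norm_num) (by norm_num))

/-- If `μ + ν = p` is a natural number, then `J_μ(x) J_ν(x) = (x / 2)^p Λ_μ(x) Λ_ν(x)`,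
at `x = 0` included. -/
theorem besselJJ_eq (μ ν x : ℝ) (p : ℕ) (h : μ + ν = p) :
    besselJJ μ ν x =
      (((x / 2) ^ p * besselLambda μ x * besselLambda ν x : ℝ) : ℂ) := by
  have key : ∀ t : ℝ, t ≠ 0 → besselJ μ t * besselJ ν t =
      (((t / 2) ^ p * besselLambda μ t * besselLambda ν t : ℝ) : ℂ) := by
    intro t ht
    have ht2 : ((t / 2 : ℝ) : ℂ) ≠ 0 := by
      exact_mod_cast div_ne_zero ht two_ne_zero
    have hp : ((t / 2 : ℝ) : ℂ) ^ (μ : ℂ) * ((t / 2 : ℝ) : ℂ) ^ (ν : ℂ)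
        = ((t / 2 : ℝ) : ℂ) ^ p := by
      rw [← Complex.cpow_add _ _ ht2, ← Complex.ofReal_add, h, Complex.ofReal_natCast,
        Complex.cpow_natCast]
    unfold besselJ
    rw [mul_mul_mul_comm, hp]
    push_cast
    ring
  unfold besselJJ
  split_ifs with hx
  · subst hx
    refine Tendsto.limUnder_eq ?_
    have hcont : ContinuousAt (fun t : ℝ =>
        (((t / 2) ^ p * besselLambda μ t * besselLambda ν t : ℝ) : ℂ)) 0 := by
      refine Complex.continuous_ofReal.continuousAt.comp ?_
      refine ContinuousAt.mul (ContinuousAt.mul (by fun_prop) ?_) ?_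
      · exact continuous_besselLambda_zero μ
      · exact continuous_besselLambda_zero ν
    refine (hcont.tendsto.mono_left nhdsWithin_le_nhds).congr' ?_
    filter_upwards [self_mem_nhdsWithin] with t ht
    exact (key t ht).symm
  · exact key x hx

/-! ### The ray model -/

/-- The random angles of the model: central azimuth and elevation angles of the clusters `c : C`,
and azimuth and elevation offsets of the subrays `s : S` that the cluster `c` scatters for the
user `l : U`. -/
inductive AngleVar (C U S : Type*)
  | azCentral (c : C)
  | elCentral (c : C)
  | azOffset (l : U) (c : C) (s : S)
  | elOffset (l : U) (c : C) (s : S)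

/-- The clustered ray model: all central angles and all offsets are independent, and each of the
four kinds has its own common (arbitrary) law. -/
structure IsRayModel {Ω C U S : Type*} [MeasurableSpace Ω] (P : Measure Ω)
    (X : AngleVar C U S → Ω → ℝ) (azC azS elC elS : Measure ℝ) : Prop where
  indep : iIndepFun X P
  law_azCentral : ∀ c, HasLaw (X (.azCentral c)) azC P
  law_elCentral : ∀ c, HasLaw (X (.elCentral c)) elC P
  law_azOffset : ∀ l c s, HasLaw (X (.azOffset l c s)) azS P
  law_elOffset : ∀ l c s, HasLaw (X (.elOffset l c s)) elS P

/-- Azimuth angle of arrival of ray `s` from user `l` through cluster `c`. -/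
def rayAz {Ω C U S : Type*} (X : AngleVar C U S → Ω → ℝ) (l : U) (c : C) (s : S) (ω : Ω) : ℝ :=
  X (.azCentral c) ω + X (.azOffset l c s) ω

/-- Elevation angle of arrival of ray `s` from user `l` through cluster `c`. -/
def rayEl {Ω C U S : Type*} (X : AngleVar C U S → Ω → ℝ) (l : U) (c : C) (s : S) (ω : Ω) : ℝ :=
  X (.elCentral c) ω + X (.elOffset l c s) ω

/-! ### The uniform circular array -/

/-- `ψ_m = 2 π m / M`. -/
noncomputable def ucaPsi (M : ℕ) (m : Fin M) : ℝ := 2 * Real.pi * (m : ℕ) / M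

/-- Steering vector of the uniform circular array with `M` antennas and spacing `d`. -/
noncomputable def ucaSteering (M : ℕ) (d φ θ : ℝ) : Fin M → ℂ := fun m =>
  Complex.exp (Complex.I *
    ((Real.pi * d / Real.sin (Real.pi / M) * Real.sin θ * Real.cos (φ - ucaPsi M m) : ℝ) : ℂ))

/-- `(1 / M²) E |a^H(φ, θ) a(φ', θ')|²` for two rays with random angles. -/
noncomputable def ucaK {Ω : Type*} [MeasurableSpace Ω] (P : Measure Ω) (M : ℕ) (d : ℝ)
    (φ θ φ' θ' : Ω → ℝ) : ℝ :=
  1 / (M : ℝ) ^ 2 *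
    ∫ ω, ‖star (ucaSteering M d (φ ω) (θ ω)) ⬝ᵥ ucaSteering M d (φ' ω) (θ' ω)‖ ^ 2 ∂P

/-- `z₁ = cos ψ_{m'} - cos ψ_m`. -/
noncomputable def ucaZ1 (M : ℕ) (m m' : Fin M) : ℝ :=
  Real.cos (ucaPsi M m') - Real.cos (ucaPsi M m)

/-- `z₂ = sin ψ_{m'} - sin ψ_m`. -/
noncomputable def ucaZ2 (M : ℕ) (m m' : Fin M) : ℝ :=
  Real.sin (ucaPsi M m') - Real.sin (ucaPsi M m)

/-- `z_T = π d / sin(π / M) √(z₁² + z₂²)`. -/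
noncomputable def ucaZT (M : ℕ) (d : ℝ) (m m' : Fin M) : ℝ :=
  Real.pi * d / Real.sin (Real.pi / M) * √(ucaZ1 M m m' ^ 2 + ucaZ2 M m m' ^ 2)

open scoped Classical in
/-- `α = tan⁻¹(z₁ / z₂)`, which is `π / 2` when `z₂ = 0`. -/
noncomputable def ucaAlpha (M : ℕ) (m m' : Fin M) : ℝ :=
  if ucaZ2 M m m' = 0 then Real.pi / 2 else Real.arctan (ucaZ1 M m m' / ucaZ2 M m m')

/-! ### The Bessel series -/

/-- Characteristic function at an integer. -/
noncomputable def chi (ν : Measure ℝ) (n : ℤ) : ℂ := charFun ν (n : ℝ)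

/-- Characteristic function at an integer of the deviation from `π / 2` of an elevation angle
with law `ν`. -/
noncomputable def chiEl (ν : Measure ℝ) (n : ℤ) : ℂ :=
  charFun (ν.map (fun x : ℝ => x - Real.pi / 2)) (n : ℝ)

/-- `ρ(n) = min(n, 0)`. -/
def rhoMin (n : ℤ) : ℤ := min n 0

/-- `ζ_c(n, n') = J_{|n'|/2 - n}(z/2) J_{|n'|/2 + n}(z/2)`. -/
noncomputable def zetaC (n n' : ℤ) (z : ℝ) : ℂ :=
  besselJJ (|(n' : ℝ)| / 2 - n) (|(n' : ℝ)| / 2 + n) (z / 2)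

/-- `ζ_s(n, n', k, k', z) = e^{-jπ(k+k')/2} J_{|n|/2 - k/2}(-z/2) J_{|n|/2 + k/2}(-z/2)
(-1)^{ρ(n)+ρ(n')} J_{|n'|/2 - k'/2}(z/2) J_{|n'|/2 + k'/2}(z/2)`. -/
noncomputable def zetaS (n n' k k' : ℤ) (z : ℝ) : ℂ :=
  Complex.exp (-(Complex.I * Real.pi * ((k : ℂ) + k') / 2)) *
    besselJJ (|(n : ℝ)| / 2 - k / 2) (|(n : ℝ)| / 2 + k / 2) (-z / 2) *
    (-1 : ℂ) ^ (rhoMin n + rhoMin n') *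
    besselJJ (|(n' : ℝ)| / 2 - k' / 2) (|(n' : ℝ)| / 2 + k' / 2) (z / 2)

/-- Term `(n, n')` of the double series for the pair of antennas `(m, m')`, for rays of different
clusters. -/
noncomputable def kcTerm (azC azS elC elS : Measure ℝ) (α z : ℝ) (n n' : ℤ) : ℂ :=
  (-1 : ℂ) ^ rhoMin n' * chi azC n' * chi azS n' * chiEl elC (2 * n) * chi elS (2 * n) *
    Complex.exp (Complex.I * n' * α) * zetaC n n' z

/-- Term `(n, n', k, k')` of the quadruple series for the pair of antennas `(m, m')`, for rays of
the same cluster. -/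
noncomputable def ksTerm (azC azS elC elS : Measure ℝ) (α z : ℝ) (n n' k k' : ℤ) : ℂ :=
  chi azC (n + n') * chi azS n * chi azS n' * chiEl elC (k + k') * chi elS k * chi elS k' *
    Complex.exp (Complex.I * ((n : ℂ) + n') * α) *
    Complex.exp (Complex.I * (Real.pi / 2) * ((k : ℂ) + k')) * zetaS n n' k k' z

/-- Partial sum over `|n| ≤ N.1`, `|n'| ≤ N.2.1`, `|k| ≤ N.2.2.1`, `|k'| ≤ N.2.2.2` of the
quadruple series. -/
noncomputable def ksPartial (azC azS elC elS : Measure ℝ) (α z : ℝ) (N : ℕ × ℕ × ℕ × ℕ) : ℂ :=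
  ∑ n ∈ Finset.Icc (-(N.1 : ℤ)) N.1, ∑ n' ∈ Finset.Icc (-(N.2.1 : ℤ)) N.2.1,
    ∑ k ∈ Finset.Icc (-(N.2.2.1 : ℤ)) N.2.2.1, ∑ k' ∈ Finset.Icc (-(N.2.2.2 : ℤ)) N.2.2.2,
      ksTerm azC azS elC elS α z n n' k k'

/-!
Write `u = θ - π / 2`, `v = φ + α` and `x = z_T / 2`. Up to a sign, the phase difference of two
antennas for a ray with angles `(φ, θ)` is `z_T sin θ sin v = 2 x cos u sin v`, so everything rests
on the double Fourier series of `exp(2 i x cos u sin v)` in `v` and `u`. In `v` it is the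
Jacobi–Anger expansion, with coefficients `J_n(2 x cos u)`. In `u`, the power series of
`J_p(2 x cos u)` is integrated term by term against `cos(k u)` over `[-π / 2, π / 2]`: by Cauchy's
formula for the integrals of `cos(u)^q cos(k u)` (`cosCoeff`) and the Chu–Vandermonde identity, the
result is the power series of `J_{(p - k) / 2}(x) J_{(p + k) / 2}(x)` (`hasSum_besselJJ`). Only the
half period with `cos u > 0` enters, and so the double series represents the `2 π`-periodic function
`(1 + sign(cos u)) exp(2 i x cos u sin v)` (`tendsto_besselSum`). All of its terms are absolutely
summable, except for those of the constant term of the exponential, which form the Fourier series of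
the square wave `1 + sign(cos u)`; its symmetric partial sums converge pointwise and are uniformly
bounded (`tendsto_squareWaveSum`, `norm_squareWaveSum_le_const`). The terms with even `k` have the
absolutely convergent sum `exp(2 i x |cos u| sin v)` (`hasSum_besselCoeff_two_mul`).

Taking expectations termwise, independence turns the exponentials into products of characteristic
functions. Hence, for different clusters, the series gives the correlation with `|sin θ|` instead of
`sin θ`, and for the same cluster it gives the correlation with the weight
`(1 + sign(sin θ)) (1 + sign(sin θ')) / 4`, by dominated convergence. Both integrands lie in
`[0, 1]` and agree with the true one when both elevation angles lie in `(0, π)`, which gives the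
error bound. The sign that `α = arctan(z₁ / z₂)` loses does no harm: for different clusters it
conjugates a number of which only the modulus matters, and for the same cluster it exchanges
the two rays, which have the same joint law (`integral_ucaCorr_signWeight`).
-/

/-! ### Fourier coefficients of the powers of `max(cos u, 0)` -/

/-- The functional equation of `1 / Γ`. It holds at `x = 0` too, since `Real.Gamma 0 = 0`. -/
theorem inv_Gamma_eq_mul (x : ℝ) : (Real.Gamma x)⁻¹ = x * (Real.Gamma (x + 1))⁻¹ := by
  rcases eq_or_ne x 0 with rfl | hx
  · simp
  · rw [Real.Gamma_add_one hx, mul_inv, ← mul_assoc, mul_inv_cancel₀ hx, one_mul]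

/-- `cosCoeff q k = (1 / π) ∫ cos(t)^q cos(k t) dt` over `[-π / 2, π / 2]`, in Cauchy's closed form
`q! / (2^q Γ((q + k) / 2 + 1) Γ((q - k) / 2 + 1))` (`1 / Γ` vanishes at the poles of `Γ`).
This is the `k`-th Fourier coefficient of the `2 π`-periodic function `2 max(cos u, 0)^q`,
which for `q = 0` is the square wave `1 + sign(cos u)`. -/
noncomputable def cosCoeff (q : ℕ) (k : ℤ) : ℝ :=
  (q.factorial : ℝ) / 2 ^ q * (Real.Gamma (((q : ℝ) + k) / 2 + 1))⁻¹ *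
    (Real.Gamma (((q : ℝ) - k) / 2 + 1))⁻¹

theorem cosCoeff_neg (q : ℕ) (k : ℤ) : cosCoeff q (-k) = cosCoeff q k := by
  unfold cosCoeff
  push_cast
  rw [sub_neg_eq_add, ← sub_eq_add_neg]
  ring

/-- The identity `2 cos(u) cos(k u) = cos((k + 1) u) + cos((k - 1) u)` on Fourier coefficients. -/
theorem cosCoeff_succ (q : ℕ) (k : ℤ) :
    cosCoeff (q + 1) k = (cosCoeff q (k + 1) + cosCoeff q (k - 1)) / 2 := by
  have h1 := inv_Gamma_eq_mul (((q : ℝ) + 1 + k) / 2)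
  have h2 := inv_Gamma_eq_mul (((q : ℝ) + 1 - k) / 2)
  unfold cosCoeff
  push_cast [Nat.factorial_succ]
  rw [show ((q : ℝ) + (k + 1)) / 2 + 1 = ((q : ℝ) + 1 + k) / 2 + 1 by ring,
    show ((q : ℝ) - (k + 1)) / 2 + 1 = ((q : ℝ) + 1 - k) / 2 by ring,
    show ((q : ℝ) + (k - 1)) / 2 + 1 = ((q : ℝ) + 1 + k) / 2 by ring,
    show ((q : ℝ) - (k - 1)) / 2 + 1 = ((q : ℝ) + 1 - k) / 2 + 1 by ring, h1, h2]
  ring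

theorem inv_Gamma_mul_inv_Gamma_one_sub (s : ℝ) :
    (Real.Gamma s)⁻¹ * (Real.Gamma (1 - s))⁻¹ = Real.sin (Real.pi * s) / Real.pi := by
  rw [← mul_inv, Real.Gamma_mul_Gamma_one_sub, inv_div]

theorem cosCoeff_zero_eq {k : ℤ} (hk : k ≠ 0) :
    cosCoeff 0 k = 2 / (Real.pi * k) * Real.sin (k * Real.pi / 2) := by
  have hk' : (k : ℝ) ≠ 0 := by exact_mod_cast hk
  have h := inv_Gamma_mul_inv_Gamma_one_sub ((k : ℝ) / 2)
  rw [inv_Gamma_eq_mul] at h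
  unfold cosCoeff
  simp only [Nat.factorial_zero, Nat.cast_one, pow_zero, div_one, one_mul, Nat.cast_zero, zero_add,
    zero_sub]
  rw [show -(k : ℝ) / 2 + 1 = 1 - k / 2 by ring,
    show (k : ℝ) * Real.pi / 2 = Real.pi * (k / 2) by ring]
  have hpi := Real.pi_ne_zero
  rw [mul_assoc] at h
  field_simp at h ⊢
  linarith

theorem cosCoeff_zero_zero : cosCoeff 0 0 = 1 := by simp [cosCoeff]

theorem abs_cosCoeff_zero_le (k : ℤ) : |cosCoeff 0 k| ≤ 1 := by
  rcases eq_or_ne k 0 with rfl | hk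
  · simp [cosCoeff_zero_zero]
  · have hk' : (k : ℝ) ≠ 0 := by exact_mod_cast hk
    have h := Real.abs_sin_le_abs (x := k * Real.pi / 2)
    rw [cosCoeff_zero_eq hk, abs_mul, abs_div, abs_mul, abs_two, abs_of_pos Real.pi_pos]
    calc 2 / (Real.pi * |(k : ℝ)|) * |Real.sin (k * Real.pi / 2)|
        ≤ 2 / (Real.pi * |(k : ℝ)|) * |k * Real.pi / 2| := by gcongr
      _ = 1 := by
        rw [abs_div, abs_mul, abs_two, abs_of_pos Real.pi_pos]
        have := abs_pos.2 hk'
        have := Real.pi_pos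
        field_simp

theorem abs_cosCoeff_le_one (q : ℕ) (k : ℤ) : |cosCoeff q k| ≤ 1 := by
  induction q generalizing k with
  | zero => exact abs_cosCoeff_zero_le k
  | succ q ih =>
    rw [cosCoeff_succ, abs_div, abs_two]
    have := abs_add_le (cosCoeff q (k + 1)) (cosCoeff q (k - 1))
    linarith [ih (k + 1), ih (k - 1)]

theorem cosCoeff_add_two_mul (q : ℕ) (k : ℤ) :
    (((q : ℝ) + 2) ^ 2 - k ^ 2) * cosCoeff (q + 2) k =
      ((q : ℝ) + 2) * (q + 1) * cosCoeff q k := by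
  have h1 := inv_Gamma_eq_mul (((q : ℝ) + k) / 2 + 1)
  have h2 := inv_Gamma_eq_mul (((q : ℝ) - k) / 2 + 1)
  unfold cosCoeff
  push_cast [Nat.factorial_succ]
  rw [h1, h2, show ((q : ℝ) + 2 + k) / 2 + 1 = ((q : ℝ) + k) / 2 + 1 + 1 by ring,
    show ((q : ℝ) + 2 - k) / 2 + 1 = ((q : ℝ) - k) / 2 + 1 + 1 by ring]
  ring

theorem one_sub_sq_mul_cosCoeff_one (k : ℤ) :
    (1 - (k : ℝ) ^ 2) * cosCoeff 1 k = 2 / Real.pi * Real.cos (k * Real.pi / 2) := by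
  have h1 := inv_Gamma_eq_mul (((1 : ℝ) + k) / 2)
  have h2 := inv_Gamma_eq_mul (((1 : ℝ) - k) / 2)
  have h := inv_Gamma_mul_inv_Gamma_one_sub (((1 : ℝ) + k) / 2)
  rw [show 1 - ((1 : ℝ) + k) / 2 = (1 - k) / 2 by ring, h1, h2,
    show Real.pi * ((1 + k) / 2) = k * Real.pi / 2 + Real.pi / 2 by ring,
    Real.sin_add_pi_div_two] at h
  unfold cosCoeff
  push_cast [Nat.factorial_one]
  linear_combination 2 * h

/-- The Fourier coefficients of `2 max(cos u, 0)^q` decay like `k⁻²`, except for `q = 0`. -/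
theorem sq_mul_abs_cosCoeff_le {q : ℕ} (hq : q ≠ 0) (k : ℤ) :
    (1 + (k : ℝ) ^ 2) * |cosCoeff q k| ≤ 3 * (q : ℝ) ^ 2 := by
  have h1 := abs_cosCoeff_le_one q k
  have h0 := abs_nonneg (cosCoeff q k)
  have hq1 : (1 : ℝ) ≤ q := by exact_mod_cast Nat.one_le_iff_ne_zero.2 hq
  have key : |((q : ℝ) ^ 2 - k ^ 2) * cosCoeff q k| ≤ (q : ℝ) ^ 2 := by
    match q, hq with
    | 1, _ =>
      have h := one_sub_sq_mul_cosCoeff_one k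
      push_cast
      rw [one_pow, h, abs_mul, abs_of_pos (by positivity)]
      have h2 := Real.abs_cos_le_one (k * Real.pi / 2)
      have h3 : 2 / Real.pi ≤ 1 := by
        rw [div_le_one Real.pi_pos]; exact Real.two_le_pi
      calc 2 / Real.pi * |Real.cos (k * Real.pi / 2)| ≤ 1 * 1 := by gcongr
        _ = 1 := one_mul 1
    | q + 2, _ =>
      have h := cosCoeff_add_two_mul q k
      push_cast
      rw [h, abs_mul, abs_of_nonneg (by positivity)]
      have h2 := abs_cosCoeff_le_one q k
      have hq0 : (0 : ℝ) ≤ q := q.cast_nonneg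
      calc ((q : ℝ) + 2) * (q + 1) * |cosCoeff q k| ≤ ((q : ℝ) + 2) * (q + 1) * 1 := by gcongr
        _ ≤ ((q : ℝ) + 2) ^ 2 := by nlinarith
  have h3 : (k : ℝ) ^ 2 * |cosCoeff q k| ≤ (q : ℝ) ^ 2 * |cosCoeff q k| + (q : ℝ) ^ 2 := by
    have e1 : (k : ℝ) ^ 2 * |cosCoeff q k| = |(k : ℝ) ^ 2 * cosCoeff q k| := by
      rw [abs_mul, abs_of_nonneg (sq_nonneg (k : ℝ))]
    have e2 : (q : ℝ) ^ 2 * |cosCoeff q k| = |(q : ℝ) ^ 2 * cosCoeff q k| := by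
      rw [abs_mul, abs_of_nonneg (sq_nonneg (q : ℝ))]
    have h4 := abs_sub_abs_le_abs_sub ((k : ℝ) ^ 2 * cosCoeff q k) ((q : ℝ) ^ 2 * cosCoeff q k)
    rw [abs_sub_comm, ← sub_mul] at h4
    linarith
  nlinarith

theorem summable_inv_one_add_sq : Summable fun k : ℤ => (1 + (k : ℝ) ^ 2)⁻¹ := by
  have h : Summable fun n : ℕ => (1 + (n : ℝ) ^ 2)⁻¹ := by
    refine Summable.of_nonneg_of_le (fun n => by positivity) (fun n => ?_)
      ((summable_nat_add_iff 1).2 (Real.summable_nat_pow_inv.2 one_lt_two) |>.mul_left 2)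
    push_cast
    rw [← div_eq_mul_inv, inv_eq_one_div, div_le_div_iff₀ (by positivity) (by positivity)]
    nlinarith [sq_nonneg ((n : ℝ) - 1)]
  refine Summable.of_nat_of_neg (by simpa using h) (by simpa using h)

theorem integral_exp_int_mul (j : ℤ) :
    ∫ t in (-(Real.pi / 2))..(Real.pi / 2), Complex.exp (Complex.I * j * t) =
      (Real.pi * cosCoeff 0 j : ℝ) := by
  rcases eq_or_ne j 0 with rfl | hj
  · simp [cosCoeff_zero_zero]
  · have hj' : (j : ℂ) ≠ 0 := by exact_mod_cast hj
    have hj'' : (j : ℝ) ≠ 0 := by exact_mod_cast hj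
    have hpi := Real.pi_ne_zero
    rw [integral_exp_mul_complex (mul_ne_zero Complex.I_ne_zero hj'), cosCoeff_zero_eq hj,
      show Real.pi * (2 / (Real.pi * j) * Real.sin (j * Real.pi / 2)) =
        2 * Real.sin (j * Real.pi / 2) / j by field_simp]
    have h := Complex.two_sin (j * Real.pi / 2)
    push_cast
    rw [h, div_eq_div_iff (mul_ne_zero Complex.I_ne_zero hj') hj',
      show Complex.I * j * -(Real.pi / 2 : ℂ) = -(j * Real.pi / 2) * Complex.I by ring,
      show Complex.I * j * (Real.pi / 2 : ℂ) = (j * Real.pi / 2) * Complex.I by ring]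
    linear_combination (-(Complex.exp (-(j * Real.pi / 2) * Complex.I) -
      Complex.exp ((j * Real.pi / 2) * Complex.I)) * j) * Complex.I_sq

theorem cosCoeff_one (k : ℤ) : cosCoeff 1 k = (cosCoeff 0 (1 - k) + cosCoeff 0 (-1 - k)) / 2 := by
  rw [show (1 : ℤ) - k = -(k - 1) by ring, show (-1 : ℤ) - k = -(k + 1) by ring, cosCoeff_neg,
    cosCoeff_neg, cosCoeff_succ 0 k]
  ring

theorem integral_cos_mul_exp (k : ℤ) :
    ∫ t in (-(Real.pi / 2))..(Real.pi / 2), Complex.exp (-(Complex.I * k * t)) * (Real.cos t : ℂ) =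
      (Real.pi * cosCoeff 1 k : ℝ) := by
  have h : ∀ t : ℝ, Complex.exp (-(Complex.I * k * t)) * (Real.cos t : ℂ) =
      (Complex.exp (Complex.I * (1 - k : ℤ) * t) + Complex.exp (Complex.I * (-1 - k : ℤ) * t)) / 2 := by
    intro t
    rw [Complex.ofReal_cos, Complex.cos, mul_div_assoc', mul_add, ← Complex.exp_add,
      ← Complex.exp_add]
    push_cast
    ring_nf
  simp_rw [h]
  rw [intervalIntegral.integral_div, intervalIntegral.integral_add, integral_exp_int_mul,
    integral_exp_int_mul, cosCoeff_one]
  · push_cast; ring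
  · exact (by fun_prop : Continuous _).intervalIntegrable _ _
  · exact (by fun_prop : Continuous _).intervalIntegrable _ _

theorem summable_cosCoeff {q : ℕ} (hq : q ≠ 0) : Summable fun k : ℤ => |cosCoeff q k| := by
  refine Summable.of_nonneg_of_le (fun k => abs_nonneg _) (fun k => ?_)
    (summable_inv_one_add_sq.mul_left (3 * (q : ℝ) ^ 2))
  rw [← div_eq_mul_inv, le_div_iff₀ (by positivity), mul_comm]
  exact sq_mul_abs_cosCoeff_le hq k

theorem norm_exp_int_mul (k : ℤ) (u : ℝ) : ‖Complex.exp (Complex.I * k * u)‖ = 1 := by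
  rw [show Complex.I * k * u = ((k * u : ℝ) : ℂ) * Complex.I by push_cast; ring]
  exact Complex.norm_exp_ofReal_mul_I _

/-- The function `2 max(cos u, 0)` on the circle `ℝ / 2πℤ`. -/
noncomputable def posCosCircle : C(AddCircle (2 * Real.pi), ℂ) :=
  ⟨fun x : Real.Angle => ((2 * max x.cos 0 : ℝ) : ℂ), by
    have := Real.Angle.continuous_cos
    fun_prop⟩

theorem posCosCircle_coe (u : ℝ) :
    posCosCircle (u : AddCircle (2 * Real.pi)) = ((2 * max (Real.cos u) 0 : ℝ) : ℂ) := by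
  change ((2 * max (Real.Angle.cos (u : Real.Angle)) 0 : ℝ) : ℂ) = _
  rw [Real.Angle.cos_coe]

/-- The integral over a period reduces to `[-π / 2, π / 2]`, where `cos` is nonnegative. -/
theorem fourierCoeff_posCosCircle (k : ℤ) [Fact (0 < 2 * Real.pi)] :
    fourierCoeff posCosCircle k = (cosCoeff 1 k : ℂ) := by
  have hpi := Real.pi_pos
  rw [fourierCoeff_eq_intervalIntegral _ _ (-Real.pi)]
  have hf : Continuous fun x : ℝ => Complex.exp (-(Complex.I * k * x)) *
      ((2 * max (Real.cos x) 0 : ℝ) : ℂ) := by fun_prop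
  have e : ∀ x : ℝ, fourier (-k) (x : AddCircle (2 * Real.pi)) •
      posCosCircle (x : AddCircle (2 * Real.pi)) =
      Complex.exp (-(Complex.I * k * x)) * ((2 * max (Real.cos x) 0 : ℝ) : ℂ) := by
    intro x
    rw [smul_eq_mul, fourier_coe_apply, posCosCircle_coe]
    congr 2
    have : (Real.pi : ℂ) ≠ 0 := by exact_mod_cast hpi.ne'
    push_cast
    field_simp
  simp_rw [e]
  rw [show -Real.pi + 2 * Real.pi = Real.pi by ring,
    ← intervalIntegral.integral_add_adjacent_intervals (b := -(Real.pi / 2))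
      (hf.intervalIntegrable _ _) (hf.intervalIntegrable _ _),
    ← intervalIntegral.integral_add_adjacent_intervals (b := Real.pi / 2) (c := Real.pi)
      (hf.intervalIntegrable _ _) (hf.intervalIntegrable _ _)]
  have z1 : ∫ x in (-Real.pi)..(-(Real.pi / 2)), Complex.exp (-(Complex.I * k * x)) *
      ((2 * max (Real.cos x) 0 : ℝ) : ℂ) = 0 := by
    rw [intervalIntegral.integral_congr (g := fun _ => (0 : ℂ)), intervalIntegral.integral_zero]
    intro x hx
    rw [Set.uIcc_of_le (by linarith)] at hx
    have : Real.cos x ≤ 0 := by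
      rw [← Real.cos_neg]
      exact Real.cos_nonpos_of_pi_div_two_le_of_le (by linarith [hx.2]) (by linarith [hx.1])
    simp [max_eq_right this]
  have z3 : ∫ x in (Real.pi / 2)..Real.pi, Complex.exp (-(Complex.I * k * x)) *
      ((2 * max (Real.cos x) 0 : ℝ) : ℂ) = 0 := by
    rw [intervalIntegral.integral_congr (g := fun _ => (0 : ℂ)), intervalIntegral.integral_zero]
    intro x hx
    rw [Set.uIcc_of_le (by linarith)] at hx
    have : Real.cos x ≤ 0 :=
      Real.cos_nonpos_of_pi_div_two_le_of_le (by linarith [hx.1]) (by linarith [hx.2])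
    simp [max_eq_right this]
  have z2 : ∫ x in (-(Real.pi / 2))..(Real.pi / 2), Complex.exp (-(Complex.I * k * x)) *
      ((2 * max (Real.cos x) 0 : ℝ) : ℂ) = 2 * (Real.pi * cosCoeff 1 k : ℝ) := by
    rw [← integral_cos_mul_exp, ← intervalIntegral.integral_const_mul]
    refine intervalIntegral.integral_congr fun x hx => ?_
    rw [Set.uIcc_of_le (by linarith)] at hx
    have := Real.cos_nonneg_of_mem_Icc hx
    simp only [max_eq_left this]
    push_cast
    ring
  rw [z1, z2, z3, zero_add, add_zero, Complex.real_smul]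
  have : (Real.pi : ℂ) ≠ 0 := by exact_mod_cast hpi.ne'
  push_cast
  field_simp

theorem hasSum_cosCoeff_one (u : ℝ) :
    HasSum (fun k : ℤ => (cosCoeff 1 k : ℂ) * Complex.exp (Complex.I * k * u))
      ((2 * max (Real.cos u) 0 : ℝ) : ℂ) := by
  have : Fact (0 < 2 * Real.pi) := ⟨Real.two_pi_pos⟩
  have hs : Summable (fourierCoeff posCosCircle) := by
    refine Summable.of_norm ?_
    simp_rw [fourierCoeff_posCosCircle, Complex.norm_real, Real.norm_eq_abs]
    exact summable_cosCoeff one_ne_zero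
  have h := has_pointwise_sum_fourier_series_of_summable hs (u : AddCircle (2 * Real.pi))
  rw [posCosCircle_coe] at h
  convert h using 2 with k
  rw [fourierCoeff_posCosCircle, smul_eq_mul, fourier_coe_apply]
  congr 2
  have : (Real.pi : ℂ) ≠ 0 := by exact_mod_cast Real.pi_ne_zero
  push_cast
  field_simp

/-- The Fourier series of `2 max(cos u, 0)^q`; the case `q = 0` is excluded because the square wave
has a conditionally convergent series. -/
theorem hasSum_cosCoeff {q : ℕ} (hq : q ≠ 0) (u : ℝ) :
    HasSum (fun k : ℤ => (cosCoeff q k : ℂ) * Complex.exp (Complex.I * k * u))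
      ((2 * max (Real.cos u) 0 ^ q : ℝ) : ℂ) := by
  induction q, Nat.one_le_iff_ne_zero.2 hq using Nat.le_induction with
  | base => simpa using hasSum_cosCoeff_one u
  | succ q hq1 ih =>
    have ih := ih (Nat.one_le_iff_ne_zero.1 hq1)
    have hp := ((Equiv.addRight (1 : ℤ)).hasSum_iff.2 ih).mul_left
      (Complex.exp (-(Complex.I * u)) / 2)
    have hm := ((Equiv.subRight (1 : ℤ)).hasSum_iff.2 ih).mul_left
      (Complex.exp (Complex.I * u) / 2)
    -- The recursion `cosCoeff_succ` is multiplication of the series by `cos u`.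
    have hcm : Real.cos u * max (Real.cos u) 0 = max (Real.cos u) 0 * max (Real.cos u) 0 := by
      rcases le_total (Real.cos u) 0 with h | h
      · simp [max_eq_right h]
      · simp [max_eq_left h]
    have hv : ((2 * max (Real.cos u) 0 ^ (q + 1) : ℝ) : ℂ) =
        Complex.exp (-(Complex.I * u)) / 2 * ((2 * max (Real.cos u) 0 ^ q : ℝ) : ℂ) +
        Complex.exp (Complex.I * u) / 2 * ((2 * max (Real.cos u) 0 ^ q : ℝ) : ℂ) := by
      obtain ⟨r, rfl⟩ := Nat.exists_eq_add_of_le' hq1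
      rw [← add_mul, show Complex.exp (-(Complex.I * u)) / 2 + Complex.exp (Complex.I * u) / 2 =
        ((Real.cos u : ℝ) : ℂ) by
          rw [Complex.ofReal_cos, Complex.cos, mul_comm Complex.I, neg_mul]; ring,
        ← Complex.ofReal_mul]
      congr 1
      rw [pow_succ, pow_succ]
      linear_combination (-2 * max (Real.cos u) 0 ^ r) * hcm
    rw [hv]
    refine (hp.add hm).congr_fun fun k => ?_
    simp only [Function.comp_apply, Equiv.coe_addRight, Equiv.subRight_apply]
    rw [cosCoeff_succ, show Complex.exp (-(Complex.I * u)) / 2 *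
        (cosCoeff q (k + 1) * Complex.exp (Complex.I * (k + 1 : ℤ) * u)) =
        cosCoeff q (k + 1) / 2 *
          (Complex.exp (-(Complex.I * u)) * Complex.exp (Complex.I * (k + 1 : ℤ) * u)) by ring,
      show Complex.exp (Complex.I * u) / 2 *
        (cosCoeff q (k - 1) * Complex.exp (Complex.I * (k - 1 : ℤ) * u)) =
        cosCoeff q (k - 1) / 2 *
          (Complex.exp (Complex.I * u) * Complex.exp (Complex.I * (k - 1 : ℤ) * u)) by ring,
      ← Complex.exp_add, ← Complex.exp_add,
      show -(Complex.I * u) + Complex.I * (k + 1 : ℤ) * u = Complex.I * k * u by push_cast; ring,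
      show Complex.I * u + Complex.I * (k - 1 : ℤ) * u = Complex.I * k * u by push_cast; ring]
    push_cast
    ring

/-! ### The Fourier series of the square wave -/

/-- Symmetric partial sum of the Fourier series of the square wave `1 + sign(cos u)`. -/
noncomputable def squareWaveSum (K : ℕ) (u : ℝ) : ℂ :=
  ∑ k ∈ Finset.Icc (-(K : ℤ)) K, (cosCoeff 0 k : ℂ) * Complex.exp (Complex.I * k * u)

/-- `1 + sign x`: the weight with which the series counts the angles with `x = cos u`. -/
noncomputable def signWeight (x : ℝ) : ℝ := if 0 < x then 2 else if x = 0 then 1 else 0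

theorem abs_sin_nat_mul_le (n : ℕ) (x : ℝ) : |Real.sin (n * x)| ≤ n * |Real.sin x| := by
  induction n with
  | zero => simp
  | succ n ih =>
    push_cast
    rw [add_mul, one_mul, Real.sin_add]
    have h1 := Real.abs_cos_le_one x
    have h2 := Real.abs_cos_le_one (n * x)
    calc |Real.sin (n * x) * Real.cos x + Real.cos (n * x) * Real.sin x|
        ≤ |Real.sin (n * x)| * |Real.cos x| + |Real.cos (n * x)| * |Real.sin x| := by
          rw [← abs_mul, ← abs_mul]; exact abs_add_le _ _
      _ ≤ |Real.sin (n * x)| * 1 + 1 * |Real.sin x| := by gcongr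
      _ ≤ (n + 1) * |Real.sin x| := by linarith

theorem abs_cosCoeff_zero_mul_cos_le {k : ℕ} (hk : k ≠ 0) (u : ℝ) :
    |cosCoeff 0 k * Real.cos (k * u)| ≤ |Real.cos u| := by
  have hk' : (0 : ℝ) < k := by exact_mod_cast Nat.pos_of_ne_zero hk
  have h1 := abs_sin_nat_mul_le k (Real.pi / 2 + u)
  have h2 := abs_sin_nat_mul_le k (Real.pi / 2 - u)
  rw [Real.sin_pi_div_two_sub] at h2
  rw [add_comm (Real.pi / 2), Real.sin_add_pi_div_two] at h1
  have h3 : |Real.sin (k * Real.pi / 2) * Real.cos (k * u)| ≤ k * |Real.cos u| := by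
    have e : Real.sin (k * Real.pi / 2) * Real.cos (k * u) =
        (Real.sin (k * (u + Real.pi / 2)) + Real.sin (k * (Real.pi / 2 - u))) / 2 := by
      rw [show (k : ℝ) * (u + Real.pi / 2) = k * Real.pi / 2 + k * u by ring,
        show (k : ℝ) * (Real.pi / 2 - u) = k * Real.pi / 2 - k * u by ring, Real.sin_add,
        Real.sin_sub]
      ring
    rw [e, abs_div, abs_two]
    have := abs_add_le (Real.sin (k * (u + Real.pi / 2))) (Real.sin (k * (Real.pi / 2 - u)))
    linarith
  have h4 : 2 / Real.pi ≤ 1 := by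
    rw [div_le_one Real.pi_pos]; exact Real.two_le_pi
  have hc := cosCoeff_zero_eq (k := (k : ℤ)) (by exact_mod_cast hk)
  rw [Int.cast_natCast] at hc
  rw [hc, show 2 / (Real.pi * k) * Real.sin (k * Real.pi / 2) * Real.cos (k * u) =
    2 / Real.pi * (Real.sin (k * Real.pi / 2) * Real.cos (k * u) / k) by
      have := Real.pi_pos; field_simp, abs_mul, abs_of_pos (by positivity), abs_div,
      abs_of_pos hk']
  calc 2 / Real.pi * (|Real.sin (k * Real.pi / 2) * Real.cos (k * u)| / k)
      ≤ 1 * (k * |Real.cos u| / k) := by gcongr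
    _ = |Real.cos u| := by field_simp

theorem squareWaveSum_zero (u : ℝ) : squareWaveSum 0 u = 1 := by
  simp [squareWaveSum, cosCoeff_zero_zero]

theorem exp_add_exp_neg (k : ℤ) (u : ℝ) :
    Complex.exp (Complex.I * k * u) + Complex.exp (Complex.I * (-k : ℤ) * u) =
      2 * (Real.cos (k * u) : ℂ) := by
  push_cast
  rw [Complex.two_cos, show Complex.I * k * u = k * u * Complex.I by ring,
    show Complex.I * -k * u = -(k * u) * Complex.I by ring]

theorem squareWaveSum_succ (K : ℕ) (u : ℝ) :
    squareWaveSum (K + 1) u = squareWaveSum K u +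
      2 * (cosCoeff 0 (K + 1 : ℕ) * Real.cos ((K + 1 : ℕ) * u) : ℝ) := by
  unfold squareWaveSum
  push_cast
  rw [Finset.sum_Icc_succ_eq_add_endpoints, cosCoeff_neg, ← mul_add, exp_add_exp_neg]
  push_cast
  ring

theorem norm_squareWaveSum_le (K : ℕ) (u : ℝ) :
    ‖squareWaveSum K u - 1‖ ≤ 2 * K * |Real.cos u| := by
  induction K with
  | zero => simp [squareWaveSum_zero]
  | succ K ih =>
    have h := abs_cosCoeff_zero_mul_cos_le K.succ_ne_zero u
    rw [squareWaveSum_succ, add_sub_right_comm]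
    refine (norm_add_le _ _).trans ?_
    rw [norm_mul, Complex.norm_real, Real.norm_eq_abs, Complex.norm_two]
    push_cast at h ⊢
    linarith

/-- Multiplying the series of the square wave by `cos u` gives that of `2 max(cos u, 0)`, up to
boundary terms. -/
theorem two_cos_mul_squareWaveSum (K : ℕ) (u : ℝ) :
    2 * (Real.cos u : ℂ) * squareWaveSum K u =
      2 * (∑ k ∈ Finset.Icc (-(K : ℤ)) K, (cosCoeff 1 k : ℂ) * Complex.exp (Complex.I * k * u)) +
      (cosCoeff 0 K * (2 * Real.cos ((K + 1) * u)) -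
        cosCoeff 0 (K + 1) * (2 * Real.cos (K * u)) : ℝ) := by
  induction K with
  | zero =>
    have := cosCoeff_succ 0 0
    rw [zero_sub, cosCoeff_neg, zero_add, zero_add] at this
    simp only [squareWaveSum_zero, cosCoeff_zero_zero, this, Nat.cast_zero, neg_zero,
      Finset.Icc_self, Finset.sum_singleton, Int.cast_zero, zero_add, one_mul, zero_mul, mul_zero,
      Complex.exp_zero, Real.cos_zero]
    push_cast
    ring
  | succ K ih =>
    rw [squareWaveSum_succ, mul_add, ih]
    push_cast
    rw [Finset.sum_Icc_succ_eq_add_endpoints, cosCoeff_neg, ← mul_add]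
    have h1 := cosCoeff_succ 0 (K + 1)
    have h2 := exp_add_exp_neg (K + 1) u
    push_cast at h2
    push_cast
    rw [h2, h1, add_sub_cancel_right]
    have h3 : Complex.cos u * Complex.cos ((K + 1) * u) * 2 =
        Complex.cos ((K + 1 + 1) * u) + Complex.cos (K * u) := by
      rw [Complex.cos_add_cos]
      ring_nf
    push_cast
    linear_combination (2 * cosCoeff 0 (K + 1)) * h3

theorem abs_cosCoeff_zero_le_inv {k : ℕ} (hk : k ≠ 0) : |cosCoeff 0 k| ≤ 1 / k := by
  have hk' : (0 : ℝ) < k := by exact_mod_cast Nat.pos_of_ne_zero hk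
  have hc := cosCoeff_zero_eq (k := (k : ℤ)) (by exact_mod_cast hk)
  have h4 : 2 / Real.pi ≤ 1 := by
    rw [div_le_one Real.pi_pos]; exact Real.two_le_pi
  rw [hc, Int.cast_natCast, abs_mul, abs_of_pos (by have := Real.pi_pos; positivity)]
  have h := Real.abs_sin_le_one (k * Real.pi / 2)
  calc 2 / (Real.pi * k) * |Real.sin (k * Real.pi / 2)| ≤ 2 / (Real.pi * k) * 1 := by
        have := Real.pi_pos; gcongr
    _ = 2 / Real.pi * (1 / k) := by have := Real.pi_pos; field_simp
    _ ≤ 1 * (1 / k) := by gcongr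
    _ = 1 / k := one_mul _

theorem abs_boundary_le {K : ℕ} (hK : K ≠ 0) (u : ℝ) :
    |cosCoeff 0 K * (2 * Real.cos ((K + 1) * u)) -
        cosCoeff 0 (K + 1) * (2 * Real.cos (K * u))| ≤ 4 / K := by
  have hk' : (0 : ℝ) < K := by exact_mod_cast Nat.pos_of_ne_zero hK
  have h1 := abs_cosCoeff_zero_le_inv hK
  have h2 := abs_cosCoeff_zero_le_inv K.succ_ne_zero
  have h3 : (1 : ℝ) / (K + 1 : ℕ) ≤ 1 / K := by push_cast; gcongr; linarith
  have c1 := Real.abs_cos_le_one ((K + 1) * u)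
  have c2 := Real.abs_cos_le_one (K * u)
  push_cast at h2
  refine (abs_sub _ _).trans ?_
  rw [abs_mul, abs_mul, abs_mul, abs_mul, abs_two]
  calc _ ≤ 1 / (K : ℝ) * (2 * 1) + 1 / K * (2 * 1) := by
        push_cast at h3
        have := h2.trans h3
        gcongr
    _ = 4 / K := by ring

theorem abs_cosCoeff_one_le {k : ℕ} (hk : k ≠ 0) :
    |cosCoeff 1 (k + 1)| ≤ 1 / k - 1 / (k + 1) := by
  have hk' : (1 : ℝ) ≤ k := by exact_mod_cast Nat.one_le_iff_ne_zero.2 hk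
  have h := congrArg abs (one_sub_sq_mul_cosCoeff_one (k + 1))
  push_cast at h
  have h4 : 2 / Real.pi ≤ 1 := by
    rw [div_le_one Real.pi_pos]; exact Real.two_le_pi
  have h5 : |2 / Real.pi * Real.cos (((k : ℝ) + 1) * Real.pi / 2)| ≤ 1 := by
    rw [abs_mul, abs_of_pos (by have := Real.pi_pos; positivity)]
    have := Real.abs_cos_le_one (((k : ℝ) + 1) * Real.pi / 2)
    calc _ ≤ (1 : ℝ) * 1 := by gcongr
      _ = 1 := one_mul 1
  rw [← h, abs_mul, abs_of_nonpos (by nlinarith)] at h5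
  rw [div_sub_div _ _ (by positivity) (by positivity), le_div_iff₀ (by positivity)]
  have := abs_nonneg (cosCoeff 1 (k + 1))
  nlinarith

theorem norm_sum_cosCoeff_one_sub_le {K₀ K : ℕ} (hK₀ : K₀ ≠ 0) (hK : K₀ ≤ K) (u : ℝ) :
    ‖(∑ k ∈ Finset.Icc (-(K : ℤ)) K, (cosCoeff 1 k : ℂ) * Complex.exp (Complex.I * k * u)) -
      ∑ k ∈ Finset.Icc (-(K₀ : ℤ)) K₀, (cosCoeff 1 k : ℂ) * Complex.exp (Complex.I * k * u)‖ ≤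
      2 * (1 / K₀ - 1 / K) := by
  induction K, hK using Nat.le_induction with
  | base => simp
  | succ K hK ih =>
    have h := abs_cosCoeff_one_le (k := K) (by lia)
    push_cast
    rw [Finset.sum_Icc_succ_eq_add_endpoints, cosCoeff_neg, ← mul_add, add_sub_assoc]
    refine (norm_add_le _ _).trans ?_
    have h2 := exp_add_exp_neg (K + 1) u
    rw [h2, norm_mul, norm_mul, Complex.norm_real, Complex.norm_real, Complex.norm_two,
      Real.norm_eq_abs, Real.norm_eq_abs]
    have := Real.abs_cos_le_one (((K + 1 : ℤ) : ℝ) * u)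
    have h3 : |cosCoeff 1 (K + 1)| * (2 * |Real.cos (((K + 1 : ℤ) : ℝ) * u)|) ≤
      (1 / K - 1 / (K + 1)) * (2 * 1) := by gcongr; exact (abs_nonneg _).trans h
    linarith

/-- Gibbs-type bound: the partial sums of the square wave are uniformly bounded. Up to
`K ≈ 1 / |cos u|` every term is at most `2 |cos u|`; from there on, summation by parts helps. -/
theorem norm_squareWaveSum_le_const (K : ℕ) (u : ℝ) : ‖squareWaveSum K u‖ ≤ 11 := by
  have hsmall : ∀ J : ℕ, ‖squareWaveSum J u‖ ≤ 1 + 2 * J * |Real.cos u| := fun J => by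
    have := norm_add_le (squareWaveSum J u - 1) 1
    rw [sub_add_cancel, norm_one] at this
    linarith [norm_squareWaveSum_le J u]
  rcases eq_or_ne (Real.cos u) 0 with h0 | h0
  · have := hsmall K
    rw [h0, abs_zero, mul_zero, add_zero] at this
    linarith
  have hc : 0 < |Real.cos u| := abs_pos.2 h0
  have hc1 := Real.abs_cos_le_one u
  set K₀ := ⌈1 / |Real.cos u|⌉₊ with hK₀
  have hlow : 1 / |Real.cos u| ≤ K₀ := Nat.le_ceil _
  have hup : (K₀ : ℝ) < 1 / |Real.cos u| + 1 := Nat.ceil_lt_add_one (by positivity)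
  have hK₀pos : (0 : ℝ) < K₀ := lt_of_lt_of_le (by positivity) hlow
  have hK₀ne : K₀ ≠ 0 := by rintro h; simp [h] at hK₀pos
  have hup' : K₀ * |Real.cos u| ≤ 2 := by
    have := mul_le_mul_of_nonneg_right hup.le hc.le
    rw [add_mul, one_div, inv_mul_cancel₀ hc.ne'] at this
    linarith
  have hinv : 1 / (K₀ : ℝ) ≤ |Real.cos u| := by
    rw [div_le_iff₀ hK₀pos]
    rw [div_le_iff₀ hc] at hlow
    linarith
  rcases le_total K K₀ with hK | hK
  · have hK' : (K : ℝ) ≤ K₀ := by exact_mod_cast hK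
    have : (K : ℝ) * |Real.cos u| ≤ K₀ * |Real.cos u| := by gcongr
    linarith [hsmall K]
  · have hK' : (K₀ : ℝ) ≤ K := by exact_mod_cast hK
    have hKinv : 1 / (K : ℝ) ≤ 1 / K₀ := by gcongr
    have e := congrArg₂ (· - ·) (two_cos_mul_squareWaveSum K u) (two_cos_mul_squareWaveSum K₀ u)
    rw [← mul_sub, add_sub_add_comm, ← mul_sub, ← Complex.ofReal_sub] at e
    have hn := congrArg norm e
    rw [norm_mul, norm_mul, Complex.norm_real, Complex.norm_two, Real.norm_eq_abs] at hn
    have hr := norm_sum_cosCoeff_one_sub_le hK₀ne hK u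
    have hb1 := abs_boundary_le (K := K) (by lia) u
    have hb2 := abs_boundary_le hK₀ne u
    have hr2 : 2 * |Real.cos u| * ‖squareWaveSum K u - squareWaveSum K₀ u‖ ≤ 12 * (1 / K₀) := by
      rw [hn]
      refine (norm_add_le _ _).trans ?_
      rw [norm_mul, Complex.norm_two, Complex.norm_real, Real.norm_eq_abs]
      have hK0 : (0 : ℝ) ≤ 1 / K := by positivity
      have := abs_sub (cosCoeff 0 K * (2 * Real.cos ((K + 1) * u)) -
        cosCoeff 0 (K + 1) * (2 * Real.cos (K * u))) (cosCoeff 0 K₀ * (2 * Real.cos ((K₀ + 1) * u)) -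
        cosCoeff 0 (K₀ + 1) * (2 * Real.cos (K₀ * u)))
      have e1 : 4 / (K : ℝ) = 4 * (1 / K) := by ring
      have e2 : 4 / (K₀ : ℝ) = 4 * (1 / K₀) := by ring
      linarith
    have hr3 : ‖squareWaveSum K u - squareWaveSum K₀ u‖ ≤ 6 := by
      by_contra! hlt
      have : 2 * |Real.cos u| * 6 < 2 * |Real.cos u| * ‖squareWaveSum K u - squareWaveSum K₀ u‖ := by
        gcongr
      linarith
    have := norm_add_le (squareWaveSum K u - squareWaveSum K₀ u) (squareWaveSum K₀ u)
    rw [sub_add_cancel] at this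
    linarith [hsmall K₀]

theorem tendsto_squareWaveSum (u : ℝ) :
    Tendsto (fun K => squareWaveSum K u) atTop (𝓝 (signWeight (Real.cos u) : ℂ)) := by
  rcases eq_or_ne (Real.cos u) 0 with h0 | h0
  · have : ∀ K, squareWaveSum K u = 1 := fun K => by
      have := norm_squareWaveSum_le K u
      rw [h0, abs_zero, mul_zero, norm_le_zero_iff, sub_eq_zero] at this
      exact this
    simp [this, h0, signWeight]
  have hsum : Tendsto (fun K : ℕ => ∑ k ∈ Finset.Icc (-(K : ℤ)) K,
      (cosCoeff 1 k : ℂ) * Complex.exp (Complex.I * k * u)) atTop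
      (𝓝 ((2 * max (Real.cos u) 0 : ℝ) : ℂ)) :=
    (hasSum_cosCoeff_one u).comp Finset.tendsto_Icc_neg
  have hb : Tendsto (fun K : ℕ => cosCoeff 0 K * (2 * Real.cos ((K + 1) * u)) -
      cosCoeff 0 (K + 1) * (2 * Real.cos (K * u))) atTop (𝓝 0) := by
    refine squeeze_zero_norm' (a := fun K : ℕ => 4 / (K : ℝ)) ?_
      (tendsto_const_div_atTop_nhds_zero_nat 4)
    filter_upwards [eventually_ne_atTop 0] with K hK using abs_boundary_le hK u
  have h := (hsum.const_mul 2).add ((Complex.continuous_ofReal.tendsto _).comp hb)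
  have h' := h.const_mul (2 * (Real.cos u : ℂ))⁻¹
  have hne : (2 * (Real.cos u : ℂ)) ≠ 0 := mul_ne_zero two_ne_zero (by exact_mod_cast h0)
  have hlim : (2 * (Real.cos u : ℂ))⁻¹ *
      (2 * ((2 * max (Real.cos u) 0 : ℝ) : ℂ) + ((0 : ℝ) : ℂ)) = (signWeight (Real.cos u) : ℂ) := by
    have hne' : (Real.cos u : ℂ) ≠ 0 := by exact_mod_cast h0
    rcases lt_or_gt_of_ne h0 with hneg | hpos
    · rw [max_eq_right hneg.le, signWeight, if_neg hneg.not_gt, if_neg h0]; simp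
    · rw [max_eq_left hpos.le, signWeight, if_pos hpos]
      push_cast at hne' ⊢
      field_simp
      ring
  rw [hlim] at h'
  refine h'.congr fun K => ?_
  rw [Function.comp_apply, ← two_cos_mul_squareWaveSum, inv_mul_cancel_left₀ hne]

/-! ### Power series of products of Bessel functions -/

theorem exists_abs_inv_Gamma_le (ν : ℝ) :
    ∃ B : ℝ, ∀ m : ℕ, |(Real.Gamma ((m : ℝ) + ν + 1))⁻¹| ≤ B := by
  obtain ⟨N, hN⟩ := exists_nat_ge (1 - ν)
  have hs : 0 ≤ ∑ m ∈ Finset.range N, |(Real.Gamma ((m : ℝ) + ν + 1))⁻¹| :=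
    Finset.sum_nonneg fun _ _ => abs_nonneg _
  refine ⟨1 + ∑ m ∈ Finset.range N, |(Real.Gamma ((m : ℝ) + ν + 1))⁻¹|, fun m => ?_⟩
  by_cases hm : N ≤ m
  · have hm' : (N : ℝ) ≤ m := by exact_mod_cast hm
    have h2 : (2 : ℝ) ≤ (m : ℝ) + ν + 1 := by linarith
    have h1 := Real.Gamma_strictMonoOn_Ici.monotoneOn (Set.mem_Ici.2 le_rfl) (Set.mem_Ici.2 h2) h2
    rw [Real.Gamma_two] at h1
    rw [abs_inv, abs_of_pos (by linarith)]
    linarith [inv_le_one_of_one_le₀ h1]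
  · have := Finset.single_le_sum (f := fun m : ℕ => |(Real.Gamma ((m : ℝ) + ν + 1))⁻¹|)
      (fun _ _ => abs_nonneg _) (Finset.mem_range.2 (not_le.1 hm))
    linarith

theorem summable_besselLambda (ν x : ℝ) : Summable fun m : ℕ =>
    ‖(-1) ^ m / ((m.factorial : ℝ) * Real.Gamma ((m : ℝ) + ν + 1)) * (x / 2) ^ (2 * m)‖ := by
  obtain ⟨B, hB⟩ := exists_abs_inv_Gamma_le ν
  refine Summable.of_nonneg_of_le (fun _ => norm_nonneg _) (fun m => ?_)
    ((Real.summable_pow_div_factorial ((x / 2) ^ 2)).mul_left B)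
  have h := hB m
  rw [Real.norm_eq_abs, abs_mul, abs_div, abs_pow, abs_neg, abs_one, one_pow, abs_mul, Nat.abs_cast,
    one_div, mul_inv, ← abs_inv (Real.Gamma _), pow_mul,
    abs_of_nonneg (a := ((x / 2) ^ 2) ^ m) (by positivity)]
  calc (m.factorial : ℝ)⁻¹ * |(Real.Gamma ((m : ℝ) + ν + 1))⁻¹| * ((x / 2) ^ 2) ^ m
      ≤ (m.factorial : ℝ)⁻¹ * B * ((x / 2) ^ 2) ^ m := by gcongr
    _ = B * (((x / 2) ^ 2) ^ m / m.factorial) := by ring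

theorem inv_Gamma_sub_nat (y : ℝ) (j : ℕ) :
    (Real.Gamma (y - j + 1))⁻¹ = j.factorial * Ring.choose y j * (Real.Gamma (y + 1))⁻¹ := by
  have hd : ∀ n : ℕ, (n.factorial : ℝ) * Ring.choose y n =
      (descPochhammer ℤ n).smeval y := fun n => by
    rw [Ring.descPochhammer_eq_factorial_smul_choose, nsmul_eq_mul]
  rw [hd]
  induction j with
  | zero => simp
  | succ j ih =>
    rw [descPochhammer_succ_right, Polynomial.smeval_mul, Polynomial.smeval_sub,
      Polynomial.smeval_X, Polynomial.smeval_natCast]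
    rw [inv_Gamma_eq_mul, show y - ((j + 1 : ℕ) : ℝ) + 1 + 1 = y - j + 1 by push_cast; ring, ih]
    push_cast
    simp
    ring

/-- The Chu–Vandermonde identity in terms of `1 / Γ`. -/
theorem sum_antidiagonal_inv_Gamma (μ ν : ℝ) (m : ℕ) :
    ∑ ij ∈ Finset.HasAntidiagonal.antidiagonal m,
      ((ij.1.factorial : ℝ) * Real.Gamma (ij.1 + μ + 1))⁻¹ *
        ((ij.2.factorial : ℝ) * Real.Gamma (ij.2 + ν + 1))⁻¹ =
      Ring.choose (μ + ν + 2 * m) m * (Real.Gamma (m + μ + 1))⁻¹ *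
        (Real.Gamma (m + ν + 1))⁻¹ := by
  rw [show μ + ν + 2 * (m : ℝ) = (m + ν) + (m + μ) by ring,
    Ring.add_choose_eq m (Commute.all _ _), Finset.sum_mul, Finset.sum_mul]
  refine Finset.sum_congr rfl fun ij hij => ?_
  obtain ⟨i, j⟩ := ij
  have hm : (i : ℝ) + j = m := by exact_mod_cast Finset.HasAntidiagonal.mem_antidiagonal.1 hij
  have h1 := inv_Gamma_sub_nat (m + μ) j
  have h2 := inv_Gamma_sub_nat (m + ν) i
  rw [show (m : ℝ) + μ - j + 1 = i + μ + 1 by rw [← hm]; ring] at h1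
  rw [show (m : ℝ) + ν - i + 1 = j + ν + 1 by rw [← hm]; ring] at h2
  simp only
  rw [mul_inv, mul_inv, h1, h2]
  have hi : (i.factorial : ℝ) ≠ 0 := by exact_mod_cast i.factorial_ne_zero
  have hj : (j.factorial : ℝ) ≠ 0 := by exact_mod_cast j.factorial_ne_zero
  field_simp

/-- The power series of `J_{(p - k) / 2}(x) J_{(p + k) / 2}(x)`. Its coefficients are those of
`J_p(2 x cos u)`, with `cos(u)^q` replaced by the Fourier coefficient `cosCoeff q k`. -/
theorem hasSum_besselJJ (p : ℕ) (k : ℤ) (x : ℝ) :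
    HasSum (fun m : ℕ => (((-1) ^ m * x ^ (p + 2 * m) / (m.factorial * (m + p).factorial) *
      cosCoeff (p + 2 * m) k : ℝ) : ℂ)) (besselJJ (p / 2 - k / 2) (p / 2 + k / 2) x) := by
  have hsum : (p : ℝ) / 2 - k / 2 + (p / 2 + k / 2) = p := by ring
  rw [besselJJ_eq _ _ x p hsum]
  refine Complex.hasSum_ofReal.2 ?_
  have s1 := summable_besselLambda (p / 2 - k / 2) x
  have s2 := summable_besselLambda (p / 2 + k / 2) x
  have hS := (summable_norm_sum_mul_antidiagonal_of_summable_norm s1 s2).of_norm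
  have hT := tsum_mul_tsum_eq_tsum_sum_antidiagonal_of_summable_norm s1 s2
  rw [mul_assoc]
  unfold besselLambda
  rw [hT]
  refine (hS.hasSum.mul_left _).congr_fun fun m => ?_
  have hm : ∀ ij ∈ Finset.HasAntidiagonal.antidiagonal m,
      (-1 : ℝ) ^ ij.1 / ((ij.1.factorial : ℝ) * Real.Gamma (ij.1 + (p / 2 - k / 2) + 1)) *
          (x / 2) ^ (2 * ij.1) *
        ((-1) ^ ij.2 / ((ij.2.factorial : ℝ) * Real.Gamma (ij.2 + (p / 2 + k / 2) + 1)) *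
          (x / 2) ^ (2 * ij.2)) =
      (-1) ^ m * (x / 2) ^ (2 * m) *
        (((ij.1.factorial : ℝ) * Real.Gamma (ij.1 + (p / 2 - k / 2) + 1))⁻¹ *
        ((ij.2.factorial : ℝ) * Real.Gamma (ij.2 + (p / 2 + k / 2) + 1))⁻¹) := by
    intro ij hij
    rw [← Finset.HasAntidiagonal.mem_antidiagonal.1 hij, mul_add, pow_add, pow_add]
    ring
  rw [Finset.sum_congr rfl hm, ← Finset.mul_sum, sum_antidiagonal_inv_Gamma, hsum,
    show (p : ℝ) + 2 * m = ((p + 2 * m : ℕ) : ℝ) by push_cast; ring, Ring.choose_natCast,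
    Nat.cast_choose ℝ (by lia), show p + 2 * m - m = m + p by lia]
  unfold cosCoeff
  push_cast
  rw [show ((p : ℝ) + 2 * m + k) / 2 + 1 = m + (p / 2 + k / 2) + 1 by ring,
    show ((p : ℝ) + 2 * m - k) / 2 + 1 = m + (p / 2 - k / 2) + 1 by ring, pow_add, pow_add, div_pow,
    div_pow]
  have hi : (m.factorial : ℝ) ≠ 0 := by exact_mod_cast m.factorial_ne_zero
  have hj : ((m + p).factorial : ℝ) ≠ 0 := by exact_mod_cast (m + p).factorial_ne_zero
  field_simp

/-! ### The double Fourier series with Bessel coefficients -/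

/-- The bijection `(a, b) ↦ (a - b, min a b)`, which sorts the products `e^{i a v} e^{-i b v}` by
frequency. -/
def diffMinEquiv : ℕ × ℕ ≃ ℤ × ℕ where
  toFun p := ((p.1 : ℤ) - p.2, min p.1 p.2)
  invFun p := (p.2 + p.1.toNat, p.2 + (-p.1).toNat)
  left_inv p := by ext <;> (simp; lia)
  right_inv p := by ext <;> simp <;> lia

/-- Relabelling of the triple series: `((n, k), m)` stands for the term `((a, b), k)` with
`n = a - b` and `m = min a b`. -/
def frequencyEquiv : (ℤ × ℤ) × ℕ ≃ (ℕ × ℕ) × ℤ where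
  toFun p := (diffMinEquiv.symm (p.1.1, p.2), p.1.2)
  invFun p := (((diffMinEquiv p.1).1, p.2), (diffMinEquiv p.1).2)
  left_inv p := by simp
  right_inv p := by simp

/-- `cosCoeff q k`, with the row `q = 0` of the square wave removed. -/
noncomputable def cosCoeffPos (q : ℕ) (k : ℤ) : ℝ := if q = 0 then 0 else cosCoeff q k

/-- The coefficient of `e^{i (a - b) v} e^{i k u}` in the expansion of
`exp(2 i x cos(u) sin(v)) = exp(x cos(u) e^{i v}) exp(-x cos(u) e^{-i v})` for `cos u > 0`, without
the constant term of the exponential series. -/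
noncomputable def expCoeff (x : ℝ) (ab : ℕ × ℕ) (k : ℤ) : ℝ :=
  x ^ (ab.1 + ab.2) * (-1) ^ ab.2 / (ab.1.factorial * ab.2.factorial) * cosCoeffPos (ab.1 + ab.2) k

/-- The coefficient of `e^{i n v} e^{i k u}` in the Bessel series. -/
noncomputable def besselCoeff (x : ℝ) (n k : ℤ) : ℂ :=
  (-1 : ℂ) ^ rhoMin n * besselJJ (|(n : ℝ)| / 2 - k / 2) (|(n : ℝ)| / 2 + k / 2) x

/-- `besselCoeff` without the square wave, which is all of its terms that are not absolutely
summable. -/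
noncomputable def besselCoeffPos (x : ℝ) (n k : ℤ) : ℂ :=
  besselCoeff x n k - if n = 0 then (cosCoeff 0 k : ℂ) else 0

theorem neg_one_zpow_neg_natCast (p : ℕ) : (-1 : ℂ) ^ (-(p : ℤ)) = (-1) ^ p := by
  rw [zpow_neg, zpow_natCast, ← inv_pow, inv_neg, inv_one]

theorem hasSum_expCoeff_symm (x : ℝ) (n k : ℤ) :
    HasSum (fun m : ℕ => (expCoeff x (diffMinEquiv.symm (n, m)) k : ℂ)) (besselCoeffPos x n k) := by
  have h := (hasSum_besselJJ n.natAbs k x).mul_left ((-1 : ℂ) ^ rhoMin n)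
  have h2 : HasSum (fun m : ℕ => if m = 0 then (if n = 0 then (cosCoeff 0 k : ℂ) else 0) else 0)
      (if n = 0 then (cosCoeff 0 k : ℂ) else 0) := hasSum_ite_eq 0 _
  have h3 := h.sub h2
  rw [show ((n.natAbs : ℕ) : ℝ) = |(n : ℝ)| by
    rw [Nat.cast_natAbs, Int.cast_abs]] at h3
  refine h3.congr_fun fun m => ?_
  unfold expCoeff
  obtain ⟨p, rfl | rfl⟩ := n.eq_nat_or_neg
  · have hr : rhoMin (p : ℤ) = 0 := by simp [rhoMin]
    have he : diffMinEquiv.symm ((p : ℤ), m) = (m + p, m) := by simp [diffMinEquiv]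
    rw [hr, he, zpow_zero, one_mul, Int.natAbs_natCast]
    simp only
    rw [show m + p + m = p + 2 * m by ring]
    unfold cosCoeffPos
    by_cases h0 : p + 2 * m = 0
    · obtain rfl : m = 0 := by lia
      obtain rfl : p = 0 := by lia
      simp
    · rw [if_neg h0, ite_eq_right_iff.2 (fun hm => if_neg (by lia)), sub_zero]
      push_cast
      ring
  · have hr : rhoMin (-(p : ℤ)) = -(p : ℤ) := by simp [rhoMin]
    have he : diffMinEquiv.symm (-(p : ℤ), m) = (m, m + p) := by simp [diffMinEquiv]
    rw [hr, he, Int.natAbs_neg, Int.natAbs_natCast, neg_one_zpow_neg_natCast]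
    simp only
    rw [show m + (m + p) = p + 2 * m by ring]
    unfold cosCoeffPos
    by_cases h0 : p + 2 * m = 0
    · obtain rfl : m = 0 := by lia
      obtain rfl : p = 0 := by lia
      simp
    · rw [if_neg h0, ite_eq_right_iff.2 (fun hm => if_neg (by lia)), sub_zero]
      push_cast
      ring

theorem sq_le_two_mul_two_pow (q : ℕ) : (q : ℝ) ^ 2 ≤ 2 * 2 ^ q := by
  have : q ^ 2 ≤ 2 * 2 ^ q := by
    induction q with
    | zero => simp
    | succ q ih =>
      rcases Nat.lt_or_ge q 3 with h | h
      · interval_cases q <;> norm_num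
      · rw [pow_succ 2 q]; nlinarith
  exact_mod_cast this

theorem abs_expCoeff_le (x : ℝ) (ab : ℕ × ℕ) (k : ℤ) :
    |expCoeff x ab k| ≤ 6 * ((2 * |x|) ^ ab.1 / ab.1.factorial * ((2 * |x|) ^ ab.2 / ab.2.factorial))
      * (1 + (k : ℝ) ^ 2)⁻¹ := by
  have hc : |cosCoeffPos (ab.1 + ab.2) k| ≤ 6 * 2 ^ (ab.1 + ab.2) * (1 + (k : ℝ) ^ 2)⁻¹ := by
    unfold cosCoeffPos
    split_ifs with h
    · rw [abs_zero]; positivity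
    · rw [← div_eq_mul_inv, le_div_iff₀ (by positivity), mul_comm]
      linarith [sq_mul_abs_cosCoeff_le h k, sq_le_two_mul_two_pow (ab.1 + ab.2)]
  unfold expCoeff
  rw [abs_mul, abs_div, abs_mul, abs_mul, abs_pow, abs_pow, abs_neg, abs_one, one_pow, mul_one,
    Nat.abs_cast, Nat.abs_cast]
  calc _ ≤ |x| ^ (ab.1 + ab.2) / (ab.1.factorial * ab.2.factorial) *
        (6 * 2 ^ (ab.1 + ab.2) * (1 + (k : ℝ) ^ 2)⁻¹) := by gcongr
    _ = _ := by
      rw [mul_pow, mul_pow, pow_add, pow_add]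
      ring

theorem summable_abs_expCoeff (x : ℝ) :
    Summable fun p : (ℕ × ℕ) × ℤ => |expCoeff x p.1 p.2| := by
  have hs := Real.summable_pow_div_factorial (2 * |x|)
  have h1 := hs.mul_of_nonneg hs (fun _ => by positivity) (fun _ => by positivity)
  have h2 := (h1.mul_left 6).mul_of_nonneg summable_inv_one_add_sq
    (fun _ => by positivity) (fun _ => by positivity)
  exact h2.of_nonneg_of_le (fun _ => abs_nonneg _) fun p => abs_expCoeff_le x p.1 p.2

theorem summable_abs_expCoeff_symm (x : ℝ) :
    Summable fun p : (ℤ × ℤ) × ℕ => |expCoeff x (diffMinEquiv.symm (p.1.1, p.2)) p.1.2| := by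
  exact frequencyEquiv.summable_iff.2 (summable_abs_expCoeff x)

theorem summable_norm_besselCoeffPos (x : ℝ) :
    Summable fun p : ℤ × ℤ => ‖besselCoeffPos x p.1 p.2‖ := by
  have h := summable_abs_expCoeff_symm x
  refine h.prod.of_nonneg_of_le (fun _ => norm_nonneg _) fun p => ?_
  have hf : Summable fun m : ℕ => ‖(expCoeff x (diffMinEquiv.symm (p.1, m)) p.2 : ℂ)‖ := by
    simpa only [Complex.norm_real, Real.norm_eq_abs] using h.prod_factor p
  rw [← (hasSum_expCoeff_symm x p.1 p.2).tsum_eq]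
  refine (norm_tsum_le_tsum_norm hf).trans (le_of_eq ?_)
  simp only [Complex.norm_real, Real.norm_eq_abs]

theorem hasSum_mul_of_summable_norm {f g : ℕ → ℂ} {a b : ℂ} (hf : HasSum f a) (hg : HasSum g b)
    (hf' : Summable fun n => ‖f n‖) (hg' : Summable fun n => ‖g n‖) :
    HasSum (fun p : ℕ × ℕ => f p.1 * g p.2) (a * b) :=
  hf.mul hg (summable_mul_of_summable_norm hf' hg')

/-- The Jacobi–Anger expansion, before collecting equal frequencies. -/
theorem hasSum_jacobiAnger (y v : ℝ) :
    HasSum (fun ab : ℕ × ℕ => ((y ^ (ab.1 + ab.2) * (-1) ^ ab.2 /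
        (ab.1.factorial * ab.2.factorial) : ℝ) : ℂ) *
        Complex.exp (Complex.I * ((ab.1 : ℤ) - ab.2 : ℤ) * v))
      (Complex.exp (2 * Complex.I * y * Real.sin v)) := by
  have hexp : ∀ w : ℂ, HasSum (fun n : ℕ => w ^ n / (n.factorial : ℂ))
      (Complex.exp w) := fun w => by
    rw [Complex.exp_eq_exp_ℂ]
    exact NormedSpace.expSeries_div_hasSum_exp w
  have hnorm : ∀ w : ℂ, Summable fun n : ℕ => ‖w ^ n / (n.factorial : ℂ)‖ := fun w =>
    NormedSpace.norm_expSeries_div_summable w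
  have h := hasSum_mul_of_summable_norm (hexp (y * Complex.exp (Complex.I * v)))
    (hexp (-(y * Complex.exp (-(Complex.I * v))))) (hnorm _) (hnorm _)
  rw [← Complex.exp_add] at h
  have e : (y * Complex.exp (Complex.I * v) + -(y * Complex.exp (-(Complex.I * v))) : ℂ) =
      2 * Complex.I * y * Real.sin v := by
    have := Complex.two_sin (v : ℂ)
    rw [neg_mul] at this
    rw [show Complex.I * v = v * Complex.I by ring]
    push_cast
    linear_combination (-Complex.I * y) * this - y * (Complex.exp (-(v * Complex.I)) -
      Complex.exp (v * Complex.I)) * Complex.I_sq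
  rw [e] at h
  refine h.congr_fun fun ab => ?_
  obtain ⟨a, b⟩ := ab
  simp only
  rw [neg_pow (y * Complex.exp (-(Complex.I * v)) : ℂ), mul_pow, mul_pow,
    ← Complex.exp_nat_mul, ← Complex.exp_nat_mul]
  have : Complex.exp (Complex.I * ((a : ℤ) - b : ℤ) * v) =
      Complex.exp (a * (Complex.I * v)) * Complex.exp (b * -(Complex.I * v)) := by
    rw [← Complex.exp_add]; push_cast; ring_nf
  rw [this]
  push_cast
  ring

theorem hasSum_cosCoeffPos (q : ℕ) (u : ℝ) :
    HasSum (fun k : ℤ => (cosCoeffPos q k : ℂ) * Complex.exp (Complex.I * k * u))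
      (if q = 0 then 0 else ((2 * max (Real.cos u) 0 ^ q : ℝ) : ℂ)) := by
  unfold cosCoeffPos
  split_ifs with h
  · simp
  · exact hasSum_cosCoeff h u

theorem norm_mul_exp_mul_exp (c : ℂ) (n k : ℤ) (u v : ℝ) :
    ‖c * Complex.exp (Complex.I * n * v) * Complex.exp (Complex.I * k * u)‖ = ‖c‖ := by
  rw [norm_mul, norm_mul, norm_exp_int_mul, norm_exp_int_mul, mul_one, mul_one]

theorem hasSum_besselCoeffPos (x u v : ℝ) :
    HasSum (fun p : ℤ × ℤ => besselCoeffPos x p.1 p.2 * Complex.exp (Complex.I * p.1 * v) *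
        Complex.exp (Complex.I * p.2 * u))
      (2 * (Complex.exp (2 * Complex.I * (x * max (Real.cos u) 0 : ℝ) * Real.sin v) - 1)) := by
  -- The triple series, summed first over `k`.
  have hs : Summable fun p : (ℕ × ℕ) × ℤ => (expCoeff x p.1 p.2 : ℂ) *
      Complex.exp (Complex.I * ((p.1.1 : ℤ) - p.1.2 : ℤ) * v) *
      Complex.exp (Complex.I * p.2 * u) := by
    refine Summable.of_norm ?_
    simp only [norm_mul_exp_mul_exp, Complex.norm_real, Real.norm_eq_abs]
    exact summable_abs_expCoeff x
  have hk : ∀ ab : ℕ × ℕ, HasSum (fun k : ℤ => (expCoeff x ab k : ℂ) *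
      Complex.exp (Complex.I * ((ab.1 : ℤ) - ab.2 : ℤ) * v) * Complex.exp (Complex.I * k * u))
      (2 * (((x * max (Real.cos u) 0) ^ (ab.1 + ab.2) * (-1) ^ ab.2 /
        (ab.1.factorial * ab.2.factorial) : ℝ) *
        Complex.exp (Complex.I * ((ab.1 : ℤ) - ab.2 : ℤ) * v) - if ab = 0 then 1 else 0)) := by
    intro ab
    have h := (hasSum_cosCoeffPos (ab.1 + ab.2) u).mul_left
      (((x ^ (ab.1 + ab.2) * (-1) ^ ab.2 / (ab.1.factorial * ab.2.factorial) : ℝ) : ℂ) *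
        Complex.exp (Complex.I * ((ab.1 : ℤ) - ab.2 : ℤ) * v))
    have hv : ((x ^ (ab.1 + ab.2) * (-1) ^ ab.2 / (ab.1.factorial * ab.2.factorial) : ℝ) : ℂ) *
        Complex.exp (Complex.I * ((ab.1 : ℤ) - ab.2 : ℤ) * v) *
        (if ab.1 + ab.2 = 0 then 0 else ((2 * max (Real.cos u) 0 ^ (ab.1 + ab.2) : ℝ) : ℂ)) =
        2 * (((x * max (Real.cos u) 0) ^ (ab.1 + ab.2) * (-1) ^ ab.2 /
          (ab.1.factorial * ab.2.factorial) : ℝ) *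
          Complex.exp (Complex.I * ((ab.1 : ℤ) - ab.2 : ℤ) * v) - if ab = 0 then 1 else 0) := by
      obtain ⟨a, b⟩ := ab
      simp only
      by_cases h0 : a + b = 0
      · obtain rfl : a = 0 := by lia
        obtain rfl : b = 0 := by lia
        simp
      · rw [if_neg h0, if_neg (by simp only [Prod.mk_eq_zero]; lia)]
        push_cast
        rw [mul_pow]
        ring
    rw [← hv]
    refine h.congr_fun fun k => ?_
    unfold expCoeff
    push_cast
    ring
  have hone : HasSum (fun ab : ℕ × ℕ => if ab = 0 then (1 : ℂ) else 0) 1 := hasSum_ite_eq 0 1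
  have hval := (hs.hasSum.prod_fiberwise hk).unique
    (((hasSum_jacobiAnger (x * max (Real.cos u) 0) v).sub hone).mul_left 2)
  -- The triple series, reindexed and summed first over `m = min a b`.
  have hr := frequencyEquiv.hasSum_iff.2 hs.hasSum
  rw [hval] at hr
  refine hr.prod_fiberwise fun p => ?_
  have h := ((hasSum_expCoeff_symm x p.1 p.2).mul_right (Complex.exp (Complex.I * p.1 * v))).mul_right
    (Complex.exp (Complex.I * p.2 * u))
  refine h.congr_fun fun m => ?_
  have hd : (((diffMinEquiv.symm (p.1, m)).1 : ℤ) - (diffMinEquiv.symm (p.1, m)).2 : ℤ) = p.1 :=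
    congrArg Prod.fst (diffMinEquiv.apply_symm_apply (p.1, m))
  simp only [Function.comp_apply, frequencyEquiv, Equiv.coe_fn_mk]
  rw [hd]

/-- Rectangular partial sum of the double Fourier series with coefficients `besselCoeff x n k`. -/
noncomputable def besselSum (x u v : ℝ) (N K : ℕ) : ℂ :=
  ∑ n ∈ Finset.Icc (-(N : ℤ)) N, ∑ k ∈ Finset.Icc (-(K : ℤ)) K,
    besselCoeff x n k * Complex.exp (Complex.I * n * v) * Complex.exp (Complex.I * k * u)

theorem besselSum_eq (x u v : ℝ) (N K : ℕ) :
    besselSum x u v N K = (∑ p ∈ Finset.Icc (-(N : ℤ)) N ×ˢ Finset.Icc (-(K : ℤ)) K,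
      besselCoeffPos x p.1 p.2 * Complex.exp (Complex.I * p.1 * v) *
        Complex.exp (Complex.I * p.2 * u)) + squareWaveSum K u := by
  have h0 : squareWaveSum K u = ∑ n ∈ Finset.Icc (-(N : ℤ)) N, ∑ k ∈ Finset.Icc (-(K : ℤ)) K,
      (if n = 0 then (cosCoeff 0 k : ℂ) else 0) * Complex.exp (Complex.I * n * v) *
        Complex.exp (Complex.I * k * u) := by
    rw [Finset.sum_eq_single (0 : ℤ)]
    · simp [squareWaveSum]
    · intro n _ hn
      simp [hn]
    · intro h
      exact absurd (Finset.mem_Icc.2 ⟨by simp, by simp⟩) h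
  rw [Finset.sum_product, h0, ← Finset.sum_add_distrib]
  unfold besselSum
  refine Finset.sum_congr rfl fun n _ => ?_
  rw [← Finset.sum_add_distrib]
  refine Finset.sum_congr rfl fun k _ => ?_
  unfold besselCoeffPos
  ring

theorem norm_besselSum_le (x u v : ℝ) (N K : ℕ) :
    ‖besselSum x u v N K‖ ≤ (∑' p : ℤ × ℤ, ‖besselCoeffPos x p.1 p.2‖) + 11 := by
  rw [besselSum_eq]
  refine (norm_add_le _ _).trans (add_le_add ((norm_sum_le _ _).trans ?_)
    (norm_squareWaveSum_le_const K u))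
  simp only [norm_mul_exp_mul_exp]
  exact (summable_norm_besselCoeffPos x).sum_le_tsum _ (fun _ _ => norm_nonneg _)

theorem tendsto_besselSum (x u v : ℝ) :
    Tendsto (fun NK : ℕ × ℕ => besselSum x u v NK.1 NK.2) atTop
      (𝓝 (signWeight (Real.cos u) *
        Complex.exp (2 * Complex.I * (x * Real.cos u : ℝ) * Real.sin v))) := by
  have h1 : Tendsto (fun NK : ℕ × ℕ =>
      Finset.Icc (-(NK.1 : ℤ)) NK.1 ×ˢ Finset.Icc (-(NK.2 : ℤ)) NK.2) atTop atTop := by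
    refine tendsto_finsetProd_atTop.comp (f := fun NK : ℕ × ℕ =>
      (Finset.Icc (-(NK.1 : ℤ)) NK.1, Finset.Icc (-(NK.2 : ℤ)) NK.2)) ?_
    rw [← prod_atTop_atTop_eq, ← prod_atTop_atTop_eq]
    exact Tendsto.prodMap Finset.tendsto_Icc_neg Finset.tendsto_Icc_neg
  have h2 := (hasSum_besselCoeffPos x u v).comp h1
  have h3 : Tendsto (fun NK : ℕ × ℕ => squareWaveSum NK.2 u) atTop
      (𝓝 (signWeight (Real.cos u) : ℂ)) := by
    rw [← prod_atTop_atTop_eq]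
    exact (tendsto_squareWaveSum u).comp tendsto_snd
  have h := h2.add h3
  have hlim : 2 * (Complex.exp (2 * Complex.I * (x * max (Real.cos u) 0 : ℝ) * Real.sin v) - 1) +
      (signWeight (Real.cos u) : ℂ) = signWeight (Real.cos u) *
        Complex.exp (2 * Complex.I * (x * Real.cos u : ℝ) * Real.sin v) := by
    rcases lt_trichotomy (Real.cos u) 0 with hc | hc | hc
    · simp [signWeight, max_eq_right hc.le, hc.not_gt, hc.ne]
    · simp [signWeight, hc]
    · rw [max_eq_left hc.le, signWeight, if_pos hc]
      push_cast
      ring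
  rw [hlim] at h
  exact h.congr fun NK => (besselSum_eq x u v NK.1 NK.2).symm

theorem besselCoeff_two_mul (x : ℝ) (n k : ℤ) :
    besselCoeff x n (2 * k) = besselCoeffPos x n (2 * k) + if (k, n) = 0 then 1 else 0 := by
  unfold besselCoeffPos
  rcases eq_or_ne n 0 with rfl | hn
  · rcases eq_or_ne k 0 with rfl | hk
    · simp [cosCoeff_zero_zero]
    · have h := cosCoeff_zero_eq (k := 2 * k) (by simpa using hk)
      push_cast at h
      rw [show 2 * (k : ℝ) * Real.pi / 2 = k * Real.pi by ring, Real.sin_int_mul_pi, mul_zero] at h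
      simp [h, hk]
  · simp [hn]

theorem summable_norm_besselCoeff_two_mul (x : ℝ) :
    Summable fun p : ℤ × ℤ => ‖besselCoeff x p.2 (2 * p.1)‖ := by
  have hinj : Function.Injective fun p : ℤ × ℤ => (p.2, 2 * p.1) := by
    rintro ⟨a, b⟩ ⟨c, d⟩ h
    simp only [Prod.mk.injEq] at h ⊢
    lia
  have h1 := (summable_norm_besselCoeffPos x).comp_injective hinj
  have h2 : Summable fun p : ℤ × ℤ => if p = 0 then (1 : ℝ) else 0 := (hasSum_ite_eq 0 1).summable
  refine (h1.add h2).of_nonneg_of_le (fun _ => norm_nonneg _) fun p => ?_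
  rw [besselCoeff_two_mul]
  refine (norm_add_le _ _).trans (add_le_add le_rfl ?_)
  split_ifs <;> simp

/-- The even part of the series: averaging over `u` and `u + π` makes it sum to a function of
`|cos u|`. -/
theorem hasSum_besselCoeff_two_mul (x u v : ℝ) :
    HasSum (fun p : ℤ × ℤ => besselCoeff x p.2 (2 * p.1) * Complex.exp (Complex.I * p.2 * v) *
        Complex.exp (Complex.I * (2 * p.1 : ℤ) * u))
      (Complex.exp (2 * Complex.I * (x * |Real.cos u| : ℝ) * Real.sin v)) := by
  have hinj : Function.Injective fun p : ℤ × ℤ => (p.2, 2 * p.1) := by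
    rintro ⟨a, b⟩ ⟨c, d⟩ h
    simp only [Prod.mk.injEq] at h ⊢
    lia
  have h := ((hasSum_besselCoeffPos x u v).add (hasSum_besselCoeffPos x (u + Real.pi) v)).div_const 2
  have hexp : ∀ k : ℤ, Complex.exp (Complex.I * k * (u + Real.pi : ℝ)) =
      (-1 : ℂ) ^ k * Complex.exp (Complex.I * k * u) := by
    intro k
    rw [← Complex.exp_pi_mul_I, ← Complex.exp_int_mul, ← Complex.exp_add]
    push_cast
    ring_nf
  have hodd : ∀ p : ℤ × ℤ, p ∉ Set.range (fun p : ℤ × ℤ => (p.2, 2 * p.1)) →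
      (besselCoeffPos x p.1 p.2 * Complex.exp (Complex.I * p.1 * v) *
        Complex.exp (Complex.I * p.2 * u) +
      besselCoeffPos x p.1 p.2 * Complex.exp (Complex.I * p.1 * v) *
        Complex.exp (Complex.I * p.2 * (u + Real.pi : ℝ))) / 2 = 0 := by
    intro p hp
    have : Odd p.2 := by
      rw [← Int.not_even_iff_odd, even_iff_two_dvd]
      rintro ⟨j, hj⟩
      exact hp ⟨(j, p.1), Prod.ext rfl hj.symm⟩
    rw [hexp, this.neg_one_zpow]
    ring
  have h1 := (hinj.hasSum_iff hodd).2 h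
  have h2 : HasSum (fun p : ℤ × ℤ => if p = 0 then (1 : ℂ) else 0) 1 := hasSum_ite_eq 0 1
  have h3 := h1.add h2
  have hlim : (2 * (Complex.exp (2 * Complex.I * (x * max (Real.cos u) 0 : ℝ) * Real.sin v) - 1) +
      2 * (Complex.exp (2 * Complex.I * (x * max (Real.cos (u + Real.pi)) 0 : ℝ) * Real.sin v) - 1))
      / 2 + 1 = Complex.exp (2 * Complex.I * (x * |Real.cos u| : ℝ) * Real.sin v) := by
    rw [Real.cos_add_pi]
    rcases le_total (Real.cos u) 0 with hc | hc
    · rw [max_eq_right hc, max_eq_left (by linarith), abs_of_nonpos hc]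
      simp
    · rw [max_eq_left hc, max_eq_right (by linarith), abs_of_nonneg hc]
      simp
  rw [hlim] at h3
  refine h3.congr_fun fun p => ?_
  simp only [Function.comp_apply]
  rw [besselCoeff_two_mul, hexp, (even_two_mul p.1).neg_one_zpow]
  rcases eq_or_ne p 0 with rfl | hp
  · simp
  · simp only [Prod.mk.eta, if_neg hp]
    ring

/-! ### Characteristic functions of the ray model -/

/-- The law of each angle of the ray model. -/
def angleLaw {C U S : Type*} (azC azS elC elS : Measure ℝ) : AngleVar C U S → Measure ℝ
  | .azCentral _ => azC
  | .elCentral _ => elC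
  | .azOffset _ _ _ => azS
  | .elOffset _ _ _ => elS

theorem chi_eq_integral (ν : Measure ℝ) (n : ℤ) :
    chi ν n = ∫ x, Complex.exp (Complex.I * n * x) ∂ν := by
  rw [chi, charFun_apply_real]
  refine integral_congr_ae (Eventually.of_forall fun x => ?_)
  simp only
  push_cast
  ring_nf

theorem chiEl_eq (ν : Measure ℝ) (n : ℤ) :
    chiEl ν n = Complex.exp (-(Complex.I * n * (Real.pi / 2))) * chi ν n := by
  rw [chi_eq_integral, chiEl, charFun_apply_real, integral_map (by fun_prop) (by fun_prop),
    ← integral_const_mul]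
  refine integral_congr_ae (Eventually.of_forall fun x => ?_)
  simp only
  rw [← Complex.exp_add]
  push_cast
  ring_nf

namespace IsRayModel

variable {Ω C U S : Type*} [MeasurableSpace Ω] {P : Measure Ω}
  {X : AngleVar C U S → Ω → ℝ} {azC azS elC elS : Measure ℝ}

theorem hasLaw (hX : IsRayModel P X azC azS elC elS) (a : AngleVar C U S) :
    HasLaw (X a) (angleLaw azC azS elC elS a) P := by
  cases a with
  | azCentral c => exact hX.law_azCentral c
  | elCentral c => exact hX.law_elCentral c
  | azOffset l c s => exact hX.law_azOffset l c s
  | elOffset l c s => exact hX.law_elOffset l c s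

theorem aemeasurable_rayAz (hX : IsRayModel P X azC azS elC elS) (l : U) (c : C) (s : S) :
    AEMeasurable (rayAz X l c s) P :=
  (hX.hasLaw (.azCentral c)).aemeasurable.add (hX.hasLaw (.azOffset l c s)).aemeasurable

theorem aemeasurable_rayEl (hX : IsRayModel P X azC azS elC elS) (l : U) (c : C) (s : S) :
    AEMeasurable (rayEl X l c s) P :=
  (hX.hasLaw (.elCentral c)).aemeasurable.add (hX.hasLaw (.elOffset l c s)).aemeasurable

theorem integral_prod_exp (hX : IsRayModel P X azC azS elC elS) {n : ℕ}
    {g : Fin n → AngleVar C U S} (hg : Function.Injective g) (t : Fin n → ℤ) :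
    ∫ ω, ∏ i, Complex.exp (Complex.I * t i * X (g i) ω) ∂P =
      ∏ i, chi (angleLaw azC azS elC elS (g i)) (t i) := by
  have hi : iIndepFun (fun i => X (g i)) P := hX.indep.precomp hg
  rw [hi.integral_fun_prod_comp (f := fun i (x : ℝ) => Complex.exp (Complex.I * t i * x))
    (fun i => (hX.hasLaw (g i)).aemeasurable) (fun i => by fun_prop)]
  refine Finset.prod_congr rfl fun i _ => ?_
  rw [chi_eq_integral, ← (hX.hasLaw (g i)).map_eq,
    integral_map (hX.hasLaw (g i)).aemeasurable (by fun_prop)]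

/-- The mixed characteristic function of the two angles of one ray. -/
theorem integral_exp_ray (hX : IsRayModel P X azC azS elC elS) (l : U) (c : C) (s : S) (α : ℝ)
    (n k : ℤ) :
    ∫ ω, Complex.exp (Complex.I * n * (rayAz X l c s ω + α : ℝ)) *
        Complex.exp (Complex.I * k * (rayEl X l c s ω - Real.pi / 2 : ℝ)) ∂P =
      chi azC n * chi azS n * chiEl elC k * chi elS k * Complex.exp (Complex.I * n * α) := by
  have h := hX.integral_prod_exp
    (g := ![.azCentral c, .azOffset l c s, .elCentral c, .elOffset l c s])
    (by intro i j h; fin_cases i <;> fin_cases j <;> simp_all) ![n, n, k, k]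
  simp only [Fin.prod_univ_four, Matrix.cons_val, angleLaw] at h
  rw [chiEl_eq, show chi azC n * chi azS n * (Complex.exp (-(Complex.I * k * (Real.pi / 2))) *
    chi elC k) * chi elS k * Complex.exp (Complex.I * n * α) =
    Complex.exp (-(Complex.I * k * (Real.pi / 2))) * Complex.exp (Complex.I * n * α) *
      (chi azC n * chi azS n * chi elC k * chi elS k) by ring, ← h, ← integral_const_mul]
  refine integral_congr_ae (Eventually.of_forall fun ω => ?_)
  simp only [rayAz, rayEl, ← Complex.exp_add]
  push_cast
  ring_nf

/-- The mixed characteristic function of the four angles of two rays of one cluster. -/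
theorem integral_exp_ray_mul_exp_ray (hX : IsRayModel P X azC azS elC elS) {l l' : U} (c : C)
    {s s' : S} (hne : (l, s) ≠ (l', s')) (α : ℝ) (n n' k k' : ℤ) :
    ∫ ω, (Complex.exp (Complex.I * n * (rayAz X l c s ω + α : ℝ)) *
        Complex.exp (Complex.I * k * (rayEl X l c s ω - Real.pi / 2 : ℝ))) *
        (Complex.exp (Complex.I * n' * (rayAz X l' c s' ω + α : ℝ)) *
        Complex.exp (Complex.I * k' * (rayEl X l' c s' ω - Real.pi / 2 : ℝ))) ∂P =
      chi azC (n + n') * chi azS n * chi azS n' * chiEl elC (k + k') * chi elS k * chi elS k' *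
        Complex.exp (Complex.I * ((n : ℂ) + n') * α) := by
  have hne' : l = l' → ¬ s = s' := fun h1 h2 => hne (by rw [h1, h2])
  have hne'' : l' = l → ¬ s' = s := fun h1 h2 => hne (by rw [h1, h2])
  have h := hX.integral_prod_exp
    (g := ![.azCentral c, .azOffset l c s, .azOffset l' c s', .elCentral c, .elOffset l c s,
      .elOffset l' c s'])
    (by intro i j h; fin_cases i <;> fin_cases j <;> simp_all) ![n + n', n, n', k + k', k, k']
  simp only [Fin.prod_univ_six, Matrix.cons_val, angleLaw] at h
  rw [chiEl_eq, show chi azC (n + n') * chi azS n * chi azS n' *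
    (Complex.exp (-(Complex.I * (k + k' : ℤ) * (Real.pi / 2))) * chi elC (k + k')) * chi elS k *
      chi elS k' * Complex.exp (Complex.I * ((n : ℂ) + n') * α) =
    Complex.exp (-(Complex.I * (k + k' : ℤ) * (Real.pi / 2))) *
      Complex.exp (Complex.I * ((n : ℂ) + n') * α) *
      (chi azC (n + n') * chi azS n * chi azS n' * chi elC (k + k') * chi elS k * chi elS k')
      by ring, ← h, ← integral_const_mul]
  refine integral_congr_ae (Eventually.of_forall fun ω => ?_)
  simp only [rayAz, rayEl, ← Complex.exp_add]
  push_cast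
  ring_nf

/-- Rays of different clusters are independent. -/
theorem indepFun_rays (hX : IsRayModel P X azC azS elC elS) (l l' : U) {c c' : C} (s s' : S)
    (hc : c ≠ c') :
    IndepFun (fun ω => (rayAz X l c s ω, rayEl X l c s ω))
      (fun ω => (rayAz X l' c' s' ω, rayEl X l' c' s' ω)) P := by
  classical
  let A : Finset (AngleVar C U S) :=
    {.azCentral c, .elCentral c, .azOffset l c s, .elOffset l c s}
  let B : Finset (AngleVar C U S) :=
    {.azCentral c', .elCentral c', .azOffset l' c' s', .elOffset l' c' s'}
  have hd : Disjoint A B := by simp [A, B, hc.symm]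
  have h := hX.indep.indepFun_finset₀ A B hd fun a => (hX.hasLaw a).aemeasurable
  exact h.comp
    (φ := fun x : A → ℝ => (x ⟨.azCentral c, by simp [A]⟩ + x ⟨.azOffset l c s, by simp [A]⟩,
      x ⟨.elCentral c, by simp [A]⟩ + x ⟨.elOffset l c s, by simp [A]⟩))
    (ψ := fun x : B → ℝ => (x ⟨.azCentral c', by simp [B]⟩ + x ⟨.azOffset l' c' s', by simp [B]⟩,
      x ⟨.elCentral c', by simp [B]⟩ + x ⟨.elOffset l' c' s', by simp [B]⟩))
    (by fun_prop) (by fun_prop)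

end IsRayModel

/-! ### Expectations of the Bessel series -/

theorem kcTerm_eq (azC azS elC elS : Measure ℝ) (α z : ℝ) (n n' : ℤ) :
    kcTerm azC azS elC elS α z n n' = besselCoeff (z / 2) n' (2 * n) *
      (chi azC n' * chi azS n' * chiEl elC (2 * n) * chi elS (2 * n) *
        Complex.exp (Complex.I * n' * α)) := by
  unfold kcTerm zetaC besselCoeff
  push_cast
  rw [show 2 * (n : ℝ) / 2 = n by ring]
  ring

theorem ksTerm_eq (azC azS elC elS : Measure ℝ) (α z : ℝ) (n n' k k' : ℤ) :
    ksTerm azC azS elC elS α z n n' k k' =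
      besselCoeff (-z / 2) n k * besselCoeff (z / 2) n' k' *
      (chi azC (n + n') * chi azS n * chi azS n' * chiEl elC (k + k') * chi elS k * chi elS k' *
        Complex.exp (Complex.I * ((n : ℂ) + n') * α)) := by
  have h : Complex.exp (Complex.I * (Real.pi / 2) * ((k : ℂ) + k')) *
      Complex.exp (-(Complex.I * Real.pi * ((k : ℂ) + k') / 2)) = 1 := by
    rw [← Complex.exp_add, ← Complex.exp_zero]
    ring_nf
  unfold ksTerm zetaS besselCoeff
  rw [zpow_add₀ (by norm_num)]
  linear_combination (chi azC (n + n') * chi azS n * chi azS n' * chiEl elC (k + k') * chi elS k *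
    chi elS k' * Complex.exp (Complex.I * ((n : ℂ) + n') * α) *
    besselJJ (|(n : ℝ)| / 2 - k / 2) (|(n : ℝ)| / 2 + k / 2) (-z / 2) *
    ((-1 : ℂ) ^ rhoMin n * (-1 : ℂ) ^ rhoMin n') *
    besselJJ (|(n' : ℝ)| / 2 - k' / 2) (|(n' : ℝ)| / 2 + k' / 2) (z / 2)) * h

/-- The signal received along a ray, with `|sin θ|` in place of `sin θ`. -/
noncomputable def absSignal (α z φ θ : ℝ) : ℂ :=
  Complex.exp (Complex.I * (z * (|Real.sin θ| * Real.sin (φ + α)) : ℝ))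

/-- The signal received along a ray, weighted by `1 + sign(sin θ)`. -/
noncomputable def signSignal (α z φ θ : ℝ) : ℂ :=
  signWeight (Real.sin θ) * Complex.exp (Complex.I * (z * (Real.sin θ * Real.sin (φ + α)) : ℝ))

theorem norm_exp_I_mul (x : ℝ) : ‖Complex.exp (Complex.I * x)‖ = 1 := by
  rw [mul_comm]
  exact Complex.norm_exp_ofReal_mul_I x

theorem signWeight_nonneg (x : ℝ) : 0 ≤ signWeight x := by
  unfold signWeight; split_ifs <;> norm_num

theorem signWeight_le_two (x : ℝ) : signWeight x ≤ 2 := by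
  unfold signWeight; split_ifs <;> norm_num

@[fun_prop]
theorem measurable_signWeight : Measurable signWeight :=
  Measurable.ite measurableSet_Ioi measurable_const
    (Measurable.ite (measurableSet_singleton 0) measurable_const measurable_const)

namespace IsRayModel

variable {Ω C U S : Type*} [MeasurableSpace Ω] {P : Measure Ω} [IsProbabilityMeasure P]
  {X : AngleVar C U S → Ω → ℝ} {azC azS elC elS : Measure ℝ}

/-- The double series is the expectation of `absSignal`, integrated term by term. -/
theorem summable_kcTerm (hX : IsRayModel P X azC azS elC elS) (l : U) (c : C) (s : S) (α z : ℝ) :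
    (Summable fun p : ℤ × ℤ => kcTerm azC azS elC elS α z p.1 p.2) ∧
    ∑' p : ℤ × ℤ, kcTerm azC azS elC elS α z p.1 p.2 =
      ∫ ω, absSignal α z (rayAz X l c s ω) (rayEl X l c s ω) ∂P := by
  have hφ := hX.aemeasurable_rayAz l c s
  have hθ := hX.aemeasurable_rayEl l c s
  set F : ℤ × ℤ → Ω → ℂ := fun p ω => besselCoeff (z / 2) p.2 (2 * p.1) *
    Complex.exp (Complex.I * p.2 * (rayAz X l c s ω + α : ℝ)) *
    Complex.exp (Complex.I * (2 * p.1 : ℤ) * (rayEl X l c s ω - Real.pi / 2 : ℝ)) with hF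
  have hn : ∀ p ω, ‖F p ω‖ = ‖besselCoeff (z / 2) p.2 (2 * p.1)‖ := fun p ω =>
    norm_mul_exp_mul_exp _ _ _ _ _
  have hint : ∀ p, Integrable (F p) P := fun p =>
    Integrable.of_bound (by simp only [hF]; fun_prop) _ (Eventually.of_forall fun ω => (hn p ω).le)
  have h := hasSum_integral_of_summable_integral_norm hint (by
    simp only [hn, integral_const, probReal_univ, one_smul]
    exact summable_norm_besselCoeff_two_mul (z / 2))
  have h1 : ∀ p, ∫ ω, F p ω ∂P = kcTerm azC azS elC elS α z p.1 p.2 := fun p => by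
    rw [kcTerm_eq, ← hX.integral_exp_ray l c s α p.2 (2 * p.1), ← integral_const_mul]
    simp only [hF, mul_assoc]
  have h2 : ∀ ω, ∑' p, F p ω = absSignal α z (rayAz X l c s ω) (rayEl X l c s ω) := fun ω => by
    rw [(hasSum_besselCoeff_two_mul (z / 2) _ _).tsum_eq, Real.cos_sub_pi_div_two, absSignal]
    push_cast
    ring_nf
  simp only [h1, h2] at h
  exact ⟨h.summable, h.tsum_eq⟩

/-- The quadruple series is the expectation of a product of two copies of `signSignal`, by dominated
convergence. -/
theorem tendsto_ksPartial (hX : IsRayModel P X azC azS elC elS) {l l' : U} (c : C) {s s' : S}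
    (hne : (l, s) ≠ (l', s')) (α z : ℝ) :
    Tendsto (ksPartial azC azS elC elS α z) atTop
      (𝓝 (∫ ω, signSignal α (-z) (rayAz X l c s ω) (rayEl X l c s ω) *
        signSignal α z (rayAz X l' c s' ω) (rayEl X l' c s' ω) ∂P)) := by
  have hφ := hX.aemeasurable_rayAz l c s
  have hθ := hX.aemeasurable_rayEl l c s
  have hφ' := hX.aemeasurable_rayAz l' c s'
  have hθ' := hX.aemeasurable_rayEl l' c s'
  set G : ℕ × ℕ × ℕ × ℕ → Ω → ℂ := fun N ω =>
    besselSum (-z / 2) (rayEl X l c s ω - Real.pi / 2) (rayAz X l c s ω + α) N.1 N.2.2.1 *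
    besselSum (z / 2) (rayEl X l' c s' ω - Real.pi / 2) (rayAz X l' c s' ω + α) N.2.1 N.2.2.2
    with hG
  have hpart : ∀ N, ksPartial azC azS elC elS α z N = ∫ ω, G N ω ∂P := by
    intro N
    have e : ∀ ω, G N ω = ∑ n ∈ Finset.Icc (-(N.1 : ℤ)) N.1,
        ∑ n' ∈ Finset.Icc (-(N.2.1 : ℤ)) N.2.1, ∑ k ∈ Finset.Icc (-(N.2.2.1 : ℤ)) N.2.2.1,
        ∑ k' ∈ Finset.Icc (-(N.2.2.2 : ℤ)) N.2.2.2,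
        besselCoeff (-z / 2) n k * besselCoeff (z / 2) n' k' *
        ((Complex.exp (Complex.I * n * (rayAz X l c s ω + α : ℝ)) *
        Complex.exp (Complex.I * k * (rayEl X l c s ω - Real.pi / 2 : ℝ))) *
        (Complex.exp (Complex.I * n' * (rayAz X l' c s' ω + α : ℝ)) *
        Complex.exp (Complex.I * k' * (rayEl X l' c s' ω - Real.pi / 2 : ℝ)))) := by
      intro ω
      simp only [hG, besselSum]
      rw [Finset.sum_mul_sum]
      refine Finset.sum_congr rfl fun n _ => Finset.sum_congr rfl fun n' _ => ?_
      rw [Finset.sum_mul_sum]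
      refine Finset.sum_congr rfl fun k _ => Finset.sum_congr rfl fun k' _ => ?_
      ring
    have hint : ∀ n n' k k' : ℤ, Integrable (fun ω =>
        besselCoeff (-z / 2) n k * besselCoeff (z / 2) n' k' *
        ((Complex.exp (Complex.I * n * (rayAz X l c s ω + α : ℝ)) *
        Complex.exp (Complex.I * k * (rayEl X l c s ω - Real.pi / 2 : ℝ))) *
        (Complex.exp (Complex.I * n' * (rayAz X l' c s' ω + α : ℝ)) *
        Complex.exp (Complex.I * k' * (rayEl X l' c s' ω - Real.pi / 2 : ℝ))))) P := by
      intro n n' k k'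
      refine Integrable.of_bound (by fun_prop)
        ‖besselCoeff (-z / 2) n k * besselCoeff (z / 2) n' k'‖ (Eventually.of_forall fun ω => ?_)
      rw [norm_mul _ (_ * _ * _), norm_mul (_ * _) (_ * _), norm_mul (Complex.exp _),
        norm_mul (Complex.exp _)]
      simp only [norm_exp_int_mul, mul_one, le_refl]
    simp only [e, ksPartial]
    rw [integral_finsetSum _ fun n _ => integrable_finsetSum _ fun n' _ =>
      integrable_finsetSum _ fun k _ => integrable_finsetSum _ fun k' _ => hint n n' k k']
    refine Finset.sum_congr rfl fun n _ => ?_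
    rw [integral_finsetSum _ fun n' _ =>
      integrable_finsetSum _ fun k _ => integrable_finsetSum _ fun k' _ => hint n n' k k']
    refine Finset.sum_congr rfl fun n' _ => ?_
    rw [integral_finsetSum _ fun k _ => integrable_finsetSum _ fun k' _ => hint n n' k k']
    refine Finset.sum_congr rfl fun k _ => ?_
    rw [integral_finsetSum _ fun k' _ => hint n n' k k']
    refine Finset.sum_congr rfl fun k' _ => ?_
    rw [integral_const_mul, hX.integral_exp_ray_mul_exp_ray c hne, ksTerm_eq]
  have hlim : ∀ x φ θ : ℝ, signWeight (Real.cos (θ - Real.pi / 2)) *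
      Complex.exp (2 * Complex.I * (x / 2 * Real.cos (θ - Real.pi / 2) : ℝ) *
        Real.sin (φ + α)) = signSignal α x φ θ := fun x φ θ => by
    rw [Real.cos_sub_pi_div_two, signSignal]
    push_cast
    ring_nf
  rw [show ksPartial azC azS elC elS α z = fun N => ∫ ω, G N ω ∂P from funext hpart]
  refine tendsto_integral_filter_of_dominated_convergence
    (fun _ => ((∑' p : ℤ × ℤ, ‖besselCoeffPos (-z / 2) p.1 p.2‖) + 11) *
      ((∑' p : ℤ × ℤ, ‖besselCoeffPos (z / 2) p.1 p.2‖) + 11))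
    (Eventually.of_forall fun N => ?_) (Eventually.of_forall fun N => Eventually.of_forall fun ω => ?_)
    (integrable_const _) (Eventually.of_forall fun ω => ?_)
  · simp only [hG, besselSum]
    fun_prop
  · rw [norm_mul]
    exact mul_le_mul (norm_besselSum_le _ _ _ _ _) (norm_besselSum_le _ _ _ _ _) (norm_nonneg _)
      ((norm_nonneg _).trans (norm_besselSum_le _ 0 0 0 0))
  · have p1 : Tendsto (fun N : ℕ × ℕ × ℕ × ℕ => (N.1, N.2.2.1)) atTop atTop :=
      tendsto_atTop.2 fun b => eventually_atTop.2 ⟨(b.1, 0, b.2, 0), fun N h => ⟨h.1, h.2.2.1⟩⟩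
    have p2 : Tendsto (fun N : ℕ × ℕ × ℕ × ℕ => (N.2.1, N.2.2.2)) atTop atTop :=
      tendsto_atTop.2 fun b => eventually_atTop.2 ⟨(0, b.1, 0, b.2), fun N h => ⟨h.2.1, h.2.2.2⟩⟩
    have hB : ∀ x φ θ : ℝ, Tendsto (fun NK : ℕ × ℕ =>
        besselSum (x / 2) (θ - Real.pi / 2) (φ + α) NK.1 NK.2) atTop (𝓝 (signSignal α x φ θ)) :=
      fun x φ θ => by
        rw [← hlim]
        exact tendsto_besselSum _ _ _
    have t1 := (hB (-z) (rayAz X l c s ω) (rayEl X l c s ω)).comp p1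
    have t2 := (hB z (rayAz X l' c s' ω) (rayEl X l' c s' ω)).comp p2
    exact t1.mul t2

end IsRayModel

/-! ### Correlation of steering vectors -/

/-- Up to a sign, the phase difference of two antennas is a sine shifted by `ucaAlpha`. The sign is
lost because `arctan` only sees the quotient `z₁ / z₂`. -/
theorem exists_sign_ucaAlpha (M : ℕ) (m m' : Fin M) :
    ∃ ε : ℝ, (ε = 1 ∨ ε = -1) ∧ ∀ φ : ℝ,
      ucaZ1 M m m' * Real.cos φ + ucaZ2 M m m' * Real.sin φ =
        ε * (√(ucaZ1 M m m' ^ 2 + ucaZ2 M m m' ^ 2) * Real.sin (φ + ucaAlpha M m m')) := by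
  unfold ucaAlpha
  generalize ucaZ1 M m m' = a
  generalize ucaZ2 M m m' = b
  split_ifs with hb
  · subst hb
    rcases le_total 0 a with ha | ha
    · refine ⟨1, Or.inl rfl, fun φ => ?_⟩
      rw [Real.sin_add_pi_div_two, zero_pow two_ne_zero, add_zero, Real.sqrt_sq ha]
      ring
    · refine ⟨-1, Or.inr rfl, fun φ => ?_⟩
      rw [Real.sin_add_pi_div_two, zero_pow two_ne_zero, add_zero, Real.sqrt_sq_eq_abs,
        abs_of_nonpos ha]
      ring
  · have hr : √(1 + (a / b) ^ 2) = √(a ^ 2 + b ^ 2) / |b| := by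
      rw [← Real.sqrt_sq_eq_abs b, ← Real.sqrt_div (by positivity)]
      congr 1
      field_simp
      ring
    have hpos : 0 < √(a ^ 2 + b ^ 2) := Real.sqrt_pos.2 (by positivity)
    have habs : 0 < |b| := abs_pos.2 hb
    have key : ∀ φ, √(a ^ 2 + b ^ 2) * Real.sin (φ + Real.arctan (a / b)) =
        |b| * Real.sin φ + a * (|b| / b) * Real.cos φ := fun φ => by
      rw [Real.sin_add, Real.sin_arctan, Real.cos_arctan, hr]
      field_simp
    rcases lt_or_gt_of_ne hb with h | h
    · refine ⟨-1, Or.inr rfl, fun φ => ?_⟩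
      rw [key, abs_of_neg h]
      field_simp
      ring
    · refine ⟨1, Or.inl rfl, fun φ => ?_⟩
      rw [key, abs_of_pos h]
      field_simp
      ring

/-- The steering vector with an arbitrary number `a` in place of `sin θ`. -/
noncomputable def ucaArray (M : ℕ) (d a φ : ℝ) : Fin M → ℂ := fun m =>
  Complex.exp (Complex.I *
    ((Real.pi * d / Real.sin (Real.pi / M) * a * Real.cos (φ - ucaPsi M m) : ℝ) : ℂ))

/-- The normalized correlation `(1 / M²) |a^H a'|²` of two steering vectors. -/
noncomputable def ucaCorr (M : ℕ) (d a φ a' φ' : ℝ) : ℝ :=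
  1 / (M : ℝ) ^ 2 * ‖star (ucaArray M d a φ) ⬝ᵥ ucaArray M d a' φ'‖ ^ 2

theorem ucaK_eq {Ω : Type*} [MeasurableSpace Ω] (P : Measure Ω) (M : ℕ) (d : ℝ)
    (φ θ φ' θ' : Ω → ℝ) :
    ucaK P M d φ θ φ' θ' =
      ∫ ω, ucaCorr M d (Real.sin (θ ω)) (φ ω) (Real.sin (θ' ω)) (φ' ω) ∂P := by
  unfold ucaK ucaCorr
  rw [integral_const_mul]
  rfl

theorem ucaCorr_nonneg (M : ℕ) (d a φ a' φ' : ℝ) : 0 ≤ ucaCorr M d a φ a' φ' := by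
  unfold ucaCorr; positivity

theorem ucaCorr_le_one (M : ℕ) (d a φ a' φ' : ℝ) : ucaCorr M d a φ a' φ' ≤ 1 := by
  have h : ‖star (ucaArray M d a φ) ⬝ᵥ ucaArray M d a' φ'‖ ≤ M := by
    refine (norm_sum_le _ _).trans (le_of_eq ?_)
    have : ∀ m : Fin M, ‖star (ucaArray M d a φ) m * ucaArray M d a' φ' m‖ = 1 := fun m => by
      rw [norm_mul, Pi.star_apply, norm_star, ucaArray, ucaArray, norm_exp_I_mul, norm_exp_I_mul,
        mul_one]
    rw [Finset.sum_congr rfl fun m _ => this m]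
    simp
  unfold ucaCorr
  rw [one_div, inv_mul_eq_div]
  exact div_le_one_of_le₀ (pow_le_pow_left₀ (norm_nonneg _) h 2) (by positivity)

theorem star_exp_I_mul (x : ℝ) :
    star (Complex.exp (Complex.I * x)) = Complex.exp (-(Complex.I * x)) := by
  rw [Complex.star_def, ← Complex.exp_conj, map_mul, Complex.conj_I, Complex.conj_ofReal, neg_mul]

theorem ucaCorr_eq_sum (M : ℕ) (d a φ a' φ' : ℝ) :
    (ucaCorr M d a φ a' φ' : ℂ) = 1 / (M : ℂ) ^ 2 * ∑ m : Fin M, ∑ m' : Fin M,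
      Complex.exp (Complex.I * (Real.pi * d / Real.sin (Real.pi / M) *
        (a * (ucaZ1 M m m' * Real.cos φ + ucaZ2 M m m' * Real.sin φ) -
          a' * (ucaZ1 M m m' * Real.cos φ' + ucaZ2 M m m' * Real.sin φ')) : ℝ)) := by
  unfold ucaCorr
  push_cast
  congr 1
  rw [← Complex.mul_conj', ← Complex.star_def, dotProduct, star_sum, Finset.sum_mul_sum]
  refine Finset.sum_congr rfl fun m _ => Finset.sum_congr rfl fun m' _ => ?_
  rw [star_mul, Pi.star_apply, Pi.star_apply, star_star]
  unfold ucaArray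
  rw [star_exp_I_mul, star_exp_I_mul, ← Complex.exp_add, ← Complex.exp_add, ← Complex.exp_add]
  congr 1
  unfold ucaZ1 ucaZ2
  rw [Real.cos_sub, Real.cos_sub, Real.cos_sub, Real.cos_sub]
  push_cast
  ring

theorem exists_sign_ucaCorr_phase (M : ℕ) (d : ℝ) (m m' : Fin M) :
    ∃ ε : ℝ, (ε = 1 ∨ ε = -1) ∧ ∀ a φ a' φ' : ℝ,
      Real.pi * d / Real.sin (Real.pi / M) *
        (a * (ucaZ1 M m m' * Real.cos φ + ucaZ2 M m m' * Real.sin φ) -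
          a' * (ucaZ1 M m m' * Real.cos φ' + ucaZ2 M m m' * Real.sin φ')) =
      ε * ucaZT M d m m' * (a * Real.sin (φ + ucaAlpha M m m')) +
        -(ε * ucaZT M d m m') * (a' * Real.sin (φ' + ucaAlpha M m m')) := by
  obtain ⟨ε, hε, h⟩ := exists_sign_ucaAlpha M m m'
  refine ⟨ε, hε, fun a φ a' φ' => ?_⟩
  rw [h, h, ucaZT]
  ring

theorem measurable_ucaCorr (M : ℕ) (d : ℝ) :
    Measurable fun p : (ℝ × ℝ) × (ℝ × ℝ) => ucaCorr M d p.1.1 p.1.2 p.2.1 p.2.2 := by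
  unfold ucaCorr dotProduct ucaArray
  simp only [Pi.star_apply, star_exp_I_mul]
  fun_prop

theorem integral_absSignal_neg {Ω : Type*} [MeasurableSpace Ω] (P : Measure Ω) (α z : ℝ)
    (φ θ : Ω → ℝ) :
    ∫ ω, absSignal α (-z) (φ ω) (θ ω) ∂P =
      (starRingEnd ℂ) (∫ ω, absSignal α z (φ ω) (θ ω) ∂P) := by
  rw [← integral_conj]
  refine integral_congr_ae (Eventually.of_forall fun ω => ?_)
  simp only [absSignal]
  rw [← Complex.star_def, star_exp_I_mul]
  push_cast
  ring_nf

theorem measurable_absSignal (α z : ℝ) :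
    Measurable fun p : ℝ × ℝ => absSignal α z p.1 p.2 := by
  unfold absSignal
  fun_prop

theorem abs_integral_sub_integral_le {Ω : Type*} [MeasurableSpace Ω] {P : Measure Ω}
    [IsProbabilityMeasure P] {f g : Ω → ℝ} {s : Set Ω} (hf : Integrable f P) (hg : Integrable g P)
    (hfg : ∀ ω, ω ∉ s → f ω = g ω) (hle : ∀ ω, |f ω - g ω| ≤ 1) :
    |∫ ω, f ω ∂P - ∫ ω, g ω ∂P| ≤ P.real s := by
  rw [← integral_sub hf hg,
    ← setIntegral_eq_integral_of_forall_compl_eq_zero (s := s) (fun ω hω => sub_eq_zero.2 (hfg ω hω)),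
    ← Real.norm_eq_abs, ← one_mul (P.real s)]
  exact norm_setIntegral_le_of_norm_le_const (measure_lt_top _ _) fun ω _ => hle ω

namespace IsRayModel

variable {Ω C U S : Type*} [MeasurableSpace Ω] {P : Measure Ω} [IsProbabilityMeasure P]
  {X : AngleVar C U S → Ω → ℝ} {azC azS elC elS : Measure ℝ}

/-- For different clusters, the series gives the correlation with `|sin θ|` instead of `sin θ`. -/
theorem integral_ucaCorr_abs (hX : IsRayModel P X azC azS elC elS) (l l' : U) {c c' : C} (s s' : S)
    (hc : c ≠ c') (M : ℕ) (d : ℝ) :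
    ∫ ω, ucaCorr M d |Real.sin (rayEl X l c s ω)| (rayAz X l c s ω)
      |Real.sin (rayEl X l' c' s' ω)| (rayAz X l' c' s' ω) ∂P =
    1 / (M : ℝ) ^ 2 * ∑ m : Fin M, ∑ m' : Fin M, ‖∑' p : ℤ × ℤ,
      kcTerm azC azS elC elS (ucaAlpha M m m') (ucaZT M d m m') p.1 p.2‖ ^ 2 := by
  have hφ := hX.aemeasurable_rayAz l c s
  have hθ := hX.aemeasurable_rayEl l c s
  have hφ' := hX.aemeasurable_rayAz l' c' s'
  have hθ' := hX.aemeasurable_rayEl l' c' s'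
  have hterm : ∀ (m m' : Fin M) (ε : ℝ), (ε = 1 ∨ ε = -1) →
      ∫ ω, absSignal (ucaAlpha M m m') (ε * ucaZT M d m m') (rayAz X l c s ω) (rayEl X l c s ω) *
        absSignal (ucaAlpha M m m') (-(ε * ucaZT M d m m')) (rayAz X l' c' s' ω)
          (rayEl X l' c' s' ω) ∂P =
      ((‖∑' p : ℤ × ℤ, kcTerm azC azS elC elS (ucaAlpha M m m') (ucaZT M d m m') p.1 p.2‖ ^ 2 : ℝ)
        : ℂ) := by
    intro m m' ε hε
    have h := (hX.indepFun_rays l l' s s' hc).integral_fun_comp_mul_comp (hφ.prodMk hθ)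
      (hφ'.prodMk hθ')
      (measurable_absSignal (ucaAlpha M m m') (ε * ucaZT M d m m')).aestronglyMeasurable
      (measurable_absSignal (ucaAlpha M m m') (-(ε * ucaZT M d m m'))).aestronglyMeasurable
    simp only at h
    rw [h, integral_absSignal_neg]
    rcases hε with rfl | rfl
    · rw [one_mul, ← (hX.summable_kcTerm l c s _ _).2, ← (hX.summable_kcTerm l' c' s' _ _).2,
        Complex.mul_conj']
      push_cast
      rfl
    · rw [neg_one_mul, integral_absSignal_neg, integral_absSignal_neg,
        ← (hX.summable_kcTerm l c s _ _).2, ← (hX.summable_kcTerm l' c' s' _ _).2,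
        Complex.conj_conj, mul_comm, Complex.mul_conj']
      push_cast
      rfl
  apply Complex.ofReal_injective
  rw [Complex.ofReal_mul, ← integral_complex_ofReal,
    show ((1 / (M : ℝ) ^ 2 : ℝ) : ℂ) = 1 / (M : ℂ) ^ 2 by push_cast; rfl]
  simp only [ucaCorr_eq_sum, Complex.ofReal_sum]
  rw [integral_const_mul]
  congr 1
  have hint : ∀ m m' : Fin M, Integrable (fun ω => Complex.exp (Complex.I *
      (Real.pi * d / Real.sin (Real.pi / M) *
        (|Real.sin (rayEl X l c s ω)| * (ucaZ1 M m m' * Real.cos (rayAz X l c s ω) +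
            ucaZ2 M m m' * Real.sin (rayAz X l c s ω)) -
          |Real.sin (rayEl X l' c' s' ω)| * (ucaZ1 M m m' * Real.cos (rayAz X l' c' s' ω) +
            ucaZ2 M m m' * Real.sin (rayAz X l' c' s' ω))) : ℝ))) P := fun m m' =>
    Integrable.of_bound (by fun_prop) 1 (Eventually.of_forall fun ω => (norm_exp_I_mul _).le)
  rw [integral_finsetSum _ fun m _ => integrable_finsetSum _ fun m' _ => hint m m']
  refine Finset.sum_congr rfl fun m _ => ?_
  rw [integral_finsetSum _ fun m' _ => hint m m']
  refine Finset.sum_congr rfl fun m' _ => ?_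
  obtain ⟨ε, hε, h⟩ := exists_sign_ucaCorr_phase M d m m'
  rw [← hterm m m' ε hε]
  refine integral_congr_ae (Eventually.of_forall fun ω => ?_)
  simp only [absSignal]
  rw [h, ← Complex.exp_add]
  push_cast
  ring_nf

/-- For one cluster, the series gives the correlation weighted by `1 + sign(sin θ)` for each of the
two rays, since the sign ambiguity of `exists_sign_ucaAlpha` amounts to exchanging the two rays. -/
theorem integral_ucaCorr_signWeight (hX : IsRayModel P X azC azS elC elS) {l l' : U} (c : C)
    {s s' : S} (hne : (l, s) ≠ (l', s')) (M : ℕ) (d : ℝ) :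
    ((∫ ω, signWeight (Real.sin (rayEl X l c s ω)) * signWeight (Real.sin (rayEl X l' c s' ω)) / 4 *
      ucaCorr M d (Real.sin (rayEl X l c s ω)) (rayAz X l c s ω)
        (Real.sin (rayEl X l' c s' ω)) (rayAz X l' c s' ω) ∂P : ℝ) : ℂ) =
    1 / (4 * (M : ℂ) ^ 2) * ∑ m : Fin M, ∑ m' : Fin M,
      ∫ ω, signSignal (ucaAlpha M m m') (-ucaZT M d m m') (rayAz X l c s ω) (rayEl X l c s ω) *
        signSignal (ucaAlpha M m m') (ucaZT M d m m') (rayAz X l' c s' ω) (rayEl X l' c s' ω) ∂P := by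
  have hφ := hX.aemeasurable_rayAz l c s
  have hθ := hX.aemeasurable_rayEl l c s
  have hφ' := hX.aemeasurable_rayAz l' c s'
  have hθ' := hX.aemeasurable_rayEl l' c s'
  have hterm : ∀ (m m' : Fin M) (ε : ℝ), (ε = 1 ∨ ε = -1) →
      ∫ ω, signSignal (ucaAlpha M m m') (ε * ucaZT M d m m') (rayAz X l c s ω) (rayEl X l c s ω) *
        signSignal (ucaAlpha M m m') (-(ε * ucaZT M d m m')) (rayAz X l' c s' ω)
          (rayEl X l' c s' ω) ∂P =
      ∫ ω, signSignal (ucaAlpha M m m') (-ucaZT M d m m') (rayAz X l c s ω) (rayEl X l c s ω) *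
        signSignal (ucaAlpha M m m') (ucaZT M d m m') (rayAz X l' c s' ω) (rayEl X l' c s' ω) ∂P := by
    rintro m m' ε (rfl | rfl)
    -- `ksPartial` depends only on the laws, so exchanging the rays does not change its limit.
    · have h := tendsto_nhds_unique
        (hX.tendsto_ksPartial c hne.symm (ucaAlpha M m m') (ucaZT M d m m'))
        (hX.tendsto_ksPartial c hne (ucaAlpha M m m') (ucaZT M d m m'))
      rw [← h]
      simp only [one_mul]
      exact integral_congr_ae (Eventually.of_forall fun ω => mul_comm _ _)
    · simp only [neg_one_mul, neg_neg]
  rw [← integral_complex_ofReal]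
  have hexp : ∀ ω, ((signWeight (Real.sin (rayEl X l c s ω)) *
      signWeight (Real.sin (rayEl X l' c s' ω)) / 4 *
      ucaCorr M d (Real.sin (rayEl X l c s ω)) (rayAz X l c s ω)
        (Real.sin (rayEl X l' c s' ω)) (rayAz X l' c s' ω) : ℝ) : ℂ) =
      1 / (4 * (M : ℂ) ^ 2) * ∑ m : Fin M, ∑ m' : Fin M,
        signWeight (Real.sin (rayEl X l c s ω)) * signWeight (Real.sin (rayEl X l' c s' ω)) *
        Complex.exp (Complex.I * (Real.pi * d / Real.sin (Real.pi / M) *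
        (Real.sin (rayEl X l c s ω) * (ucaZ1 M m m' * Real.cos (rayAz X l c s ω) +
            ucaZ2 M m m' * Real.sin (rayAz X l c s ω)) -
          Real.sin (rayEl X l' c s' ω) * (ucaZ1 M m m' * Real.cos (rayAz X l' c s' ω) +
            ucaZ2 M m m' * Real.sin (rayAz X l' c s' ω))) : ℝ)) := fun ω => by
    rw [Complex.ofReal_mul, ucaCorr_eq_sum]
    simp only [← Finset.mul_sum]
    push_cast
    ring
  simp only [hexp]
  rw [integral_const_mul]
  congr 1
  have hint : ∀ m m' : Fin M, Integrable (fun ω =>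
      signWeight (Real.sin (rayEl X l c s ω)) * signWeight (Real.sin (rayEl X l' c s' ω)) *
      Complex.exp (Complex.I *
      (Real.pi * d / Real.sin (Real.pi / M) *
        (Real.sin (rayEl X l c s ω) * (ucaZ1 M m m' * Real.cos (rayAz X l c s ω) +
            ucaZ2 M m m' * Real.sin (rayAz X l c s ω)) -
          Real.sin (rayEl X l' c s' ω) * (ucaZ1 M m m' * Real.cos (rayAz X l' c s' ω) +
            ucaZ2 M m m' * Real.sin (rayAz X l' c s' ω))) : ℝ))) P := fun m m' => by
    refine Integrable.of_bound (by fun_prop) (2 * 2) (Eventually.of_forall fun ω => ?_)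
    rw [norm_mul, norm_mul, norm_exp_I_mul, mul_one, Complex.norm_real, Complex.norm_real,
      Real.norm_of_nonneg (signWeight_nonneg _), Real.norm_of_nonneg (signWeight_nonneg _)]
    exact mul_le_mul (signWeight_le_two _) (signWeight_le_two _) (signWeight_nonneg _) zero_le_two
  rw [integral_finsetSum _ fun m _ => integrable_finsetSum _ fun m' _ => hint m m']
  refine Finset.sum_congr rfl fun m _ => ?_
  rw [integral_finsetSum _ fun m' _ => hint m m']
  refine Finset.sum_congr rfl fun m' _ => ?_
  obtain ⟨ε, hε, h⟩ := exists_sign_ucaCorr_phase M d m m'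
  rw [← hterm m m' ε hε]
  refine integral_congr_ae (Eventually.of_forall fun ω => ?_)
  simp only [signSignal]
  rw [h, mul_mul_mul_comm (signWeight _ : ℂ) (Complex.exp _), ← Complex.exp_add]
  push_cast
  ring_nf

theorem integrable_ucaCorr (M : ℕ) (d : ℝ) {a φ a' φ' : Ω → ℝ} (ha : AEMeasurable a P)
    (hφ : AEMeasurable φ P) (ha' : AEMeasurable a' P) (hφ' : AEMeasurable φ' P) :
    Integrable (fun ω => ucaCorr M d (a ω) (φ ω) (a' ω) (φ' ω)) P := by
  refine Integrable.of_bound ((measurable_ucaCorr M d).comp_aemeasurable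
    ((ha.prodMk hφ).prodMk (ha'.prodMk hφ'))).aestronglyMeasurable 1
    (Eventually.of_forall fun ω => ?_)
  rw [Real.norm_of_nonneg (ucaCorr_nonneg _ _ _ _ _ _)]
  exact ucaCorr_le_one _ _ _ _ _ _

theorem abs_ucaK_sub_le_of_ne (hX : IsRayModel P X azC azS elC elS) (l l' : U) {c c' : C}
    (s s' : S) (hc : c ≠ c') (M : ℕ) (d : ℝ) :
    |ucaK P M d (rayAz X l c s) (rayEl X l c s) (rayAz X l' c' s') (rayEl X l' c' s') -
      1 / (M : ℝ) ^ 2 * ∑ m : Fin M, ∑ m' : Fin M, ‖∑' p : ℤ × ℤ,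
        kcTerm azC azS elC elS (ucaAlpha M m m') (ucaZT M d m m') p.1 p.2‖ ^ 2| ≤
    P.real {ω | ¬ (rayEl X l c s ω ∈ Set.Ioo 0 Real.pi ∧
      rayEl X l' c' s' ω ∈ Set.Ioo 0 Real.pi)} := by
  have hφ := hX.aemeasurable_rayAz l c s
  have hθ := hX.aemeasurable_rayEl l c s
  have hφ' := hX.aemeasurable_rayAz l' c' s'
  have hθ' := hX.aemeasurable_rayEl l' c' s'
  rw [← hX.integral_ucaCorr_abs l l' s s' hc M d, ucaK_eq]
  refine abs_integral_sub_integral_le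
    (integrable_ucaCorr M d (by fun_prop) hφ (by fun_prop) hφ')
    (integrable_ucaCorr M d (by fun_prop) hφ (by fun_prop) hφ') (fun ω hω => ?_) fun ω => ?_
  · obtain ⟨h1, h2⟩ := not_not.1 hω
    rw [abs_of_pos (Real.sin_pos_of_mem_Ioo h1), abs_of_pos (Real.sin_pos_of_mem_Ioo h2)]
  · exact abs_sub_le_of_nonneg_of_le (ucaCorr_nonneg _ _ _ _ _ _) (ucaCorr_le_one _ _ _ _ _ _)
      (ucaCorr_nonneg _ _ _ _ _ _) (ucaCorr_le_one _ _ _ _ _ _)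

theorem norm_ucaK_sub_le_of_same (hX : IsRayModel P X azC azS elC elS) {l l' : U} (c : C)
    {s s' : S} (hne : (l, s) ≠ (l', s')) (M : ℕ) (d : ℝ) :
    ‖(ucaK P M d (rayAz X l c s) (rayEl X l c s) (rayAz X l' c s') (rayEl X l' c s') : ℂ) -
      1 / (4 * (M : ℂ) ^ 2) * ∑ m : Fin M, ∑ m' : Fin M,
      ∫ ω, signSignal (ucaAlpha M m m') (-ucaZT M d m m') (rayAz X l c s ω) (rayEl X l c s ω) *
        signSignal (ucaAlpha M m m') (ucaZT M d m m') (rayAz X l' c s' ω) (rayEl X l' c s' ω) ∂P‖ ≤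
    P.real {ω | ¬ (rayEl X l c s ω ∈ Set.Ioo 0 Real.pi ∧
      rayEl X l' c s' ω ∈ Set.Ioo 0 Real.pi)} := by
  have hφ := hX.aemeasurable_rayAz l c s
  have hθ := hX.aemeasurable_rayEl l c s
  have hφ' := hX.aemeasurable_rayAz l' c s'
  have hθ' := hX.aemeasurable_rayEl l' c s'
  rw [← hX.integral_ucaCorr_signWeight c hne M d, ucaK_eq, ← Complex.ofReal_sub, Complex.norm_real,
    Real.norm_eq_abs]
  have hw : ∀ x y : ℝ, 0 ≤ signWeight x * signWeight y / 4 ∧ signWeight x * signWeight y / 4 ≤ 1 :=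
    fun x y => by
      have hx := signWeight_nonneg x
      have hy := signWeight_nonneg y
      have := mul_le_mul (signWeight_le_two x) (signWeight_le_two y) hy zero_le_two
      exact ⟨by positivity, by linarith⟩
  have hcorr : Integrable (fun ω => ucaCorr M d (Real.sin (rayEl X l c s ω)) (rayAz X l c s ω)
      (Real.sin (rayEl X l' c s' ω)) (rayAz X l' c s' ω)) P :=
    integrable_ucaCorr M d (by fun_prop) hφ (by fun_prop) hφ'
  refine abs_integral_sub_integral_le hcorr
    (hcorr.bdd_mul (c := 1) (by fun_prop) (Eventually.of_forall fun ω => ?_))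
    (fun ω hω => ?_) fun ω => ?_
  · rw [Real.norm_of_nonneg (hw _ _).1]
    exact (hw _ _).2
  · obtain ⟨h1, h2⟩ := not_not.1 hω
    rw [signWeight, signWeight, if_pos (Real.sin_pos_of_mem_Ioo h1),
      if_pos (Real.sin_pos_of_mem_Ioo h2)]
    ring
  · have h0 := ucaCorr_nonneg M d (Real.sin (rayEl X l c s ω)) (rayAz X l c s ω)
      (Real.sin (rayEl X l' c s' ω)) (rayAz X l' c s' ω)
    have h1 := ucaCorr_le_one M d (Real.sin (rayEl X l c s ω)) (rayAz X l c s ω)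
      (Real.sin (rayEl X l' c s' ω)) (rayAz X l' c s' ω)
    obtain ⟨w0, w1⟩ := hw (Real.sin (rayEl X l c s ω)) (Real.sin (rayEl X l' c s' ω))
    exact abs_sub_le_of_nonneg_of_le h0 h1 (mul_nonneg w0 h0) (mul_le_one₀ w1 h0 h1)

end IsRayModel

/-! ### The correlation coefficients -/

theorem lemma2 {Ω C U S : Type*} [MeasurableSpace Ω] (P : Measure Ω) [IsProbabilityMeasure P]
    (X : AngleVar C U S → Ω → ℝ) (azC azS elC elS : Measure ℝ)
    (hX : IsRayModel P X azC azS elC elS) (M : ℕ) (hM : 2 ≤ M) (d : ℝ) (hd : 0 < d) :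
    -- rays of two different clusters
    (∀ (l l' : U) (c c' : C) (s s' : S), c ≠ c' →
      (∀ m m' : Fin M, Summable fun p : ℤ × ℤ =>
        kcTerm azC azS elC elS (ucaAlpha M m m') (ucaZT M d m m') p.1 p.2) ∧
      ((∀ᵐ ω ∂P, rayEl X l c s ω ∈ Set.Ioo 0 Real.pi ∧
          rayEl X l' c' s' ω ∈ Set.Ioo 0 Real.pi) →
        ucaK P M d (rayAz X l c s) (rayEl X l c s) (rayAz X l' c' s') (rayEl X l' c' s') =
          1 / (M : ℝ) ^ 2 * ∑ m : Fin M, ∑ m' : Fin M, ‖∑' p : ℤ × ℤ,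
            kcTerm azC azS elC elS (ucaAlpha M m m') (ucaZT M d m m') p.1 p.2‖ ^ 2) ∧
      |ucaK P M d (rayAz X l c s) (rayEl X l c s) (rayAz X l' c' s') (rayEl X l' c' s') -
          1 / (M : ℝ) ^ 2 * ∑ m : Fin M, ∑ m' : Fin M, ‖∑' p : ℤ × ℤ,
            kcTerm azC azS elC elS (ucaAlpha M m m') (ucaZT M d m m') p.1 p.2‖ ^ 2| ≤
        P.real {ω | ¬ (rayEl X l c s ω ∈ Set.Ioo 0 Real.pi ∧
          rayEl X l' c' s' ω ∈ Set.Ioo 0 Real.pi)}) ∧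
    -- two different rays of one cluster
    (∀ (l l' : U) (c : C) (s s' : S), (l, s) ≠ (l', s') →
      ∃ T : Fin M → Fin M → ℂ,
        (∀ m m' : Fin M, Tendsto
          (ksPartial azC azS elC elS (ucaAlpha M m m') (ucaZT M d m m')) atTop (𝓝 (T m m'))) ∧
        ((∀ᵐ ω ∂P, rayEl X l c s ω ∈ Set.Ioo 0 Real.pi ∧
            rayEl X l' c s' ω ∈ Set.Ioo 0 Real.pi) →
          (ucaK P M d (rayAz X l c s) (rayEl X l c s) (rayAz X l' c s') (rayEl X l' c s') : ℂ) =
            1 / (4 * (M : ℂ) ^ 2) * ∑ m : Fin M, ∑ m' : Fin M, T m m') ∧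
        ‖(ucaK P M d (rayAz X l c s) (rayEl X l c s) (rayAz X l' c s') (rayEl X l' c s') : ℂ) -
            1 / (4 * (M : ℂ) ^ 2) * ∑ m : Fin M, ∑ m' : Fin M, T m m'‖ ≤
          P.real {ω | ¬ (rayEl X l c s ω ∈ Set.Ioo 0 Real.pi ∧
            rayEl X l' c s' ω ∈ Set.Ioo 0 Real.pi)}) := by
  -- The error bound contains the exact formula: its right-hand side vanishes in that case.
  have hnull : ∀ {p : Ω → Prop}, (∀ᵐ ω ∂P, p ω) → P.real {ω | ¬ p ω} = 0 := fun h => by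
    rw [measureReal_def, ae_iff.1 h, ENNReal.toReal_zero]
  refine ⟨fun l l' c c' s s' hc => ⟨fun m m' => (hX.summable_kcTerm l c s _ _).1, fun h => ?_,
    hX.abs_ucaK_sub_le_of_ne l l' s s' hc M d⟩, fun l l' c s s' hne =>
    ⟨_, fun m m' => hX.tendsto_ksPartial c hne _ _, fun h => ?_,
      hX.norm_ucaK_sub_le_of_same c hne M d⟩⟩
  · have hle := hX.abs_ucaK_sub_le_of_ne l l' s s' hc M d
    rw [hnull h] at hle
    exact sub_eq_zero.1 (abs_nonpos_iff.1 hle)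
  · have hle := hX.norm_ucaK_sub_le_of_same c hne M d
    rw [hnull h] at hle
    exact sub_eq_zero.1 (norm_le_zero_iff.1 hle)
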